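/- Let $\mathcal X,\mathcal Y$ be real Hilbert spaces, let $f:\mathcal X\to(-\infty,+\infty]$ and $g:\mathcal Y\to(-\infty,+\infty]$ be proper, convex and lower semicontinuous, and let $A:\mathcal X\to\mathcal Y$ be bounded and linear. Let $g^*$ be the Fenchel conjugate of $g$, $L(u,v)=f(u)+\langle v,Au\rangle-g^*(v)$, and let $\mathcal S$ be the set of primal-dual solutions, i.e. of pairs $(\bar x,\bar y)\in\mathcal X\times\mathcal Y$ with $-A^*\bar y\in\partial f(\bar x)$ and $A\bar x\in\partial g^*(\bar y)$. Let $\alpha,\beta,\delta:[0,\infty)\to\mathbb R$ be absolutely continuous on compact intervals, with $\beta>0$, $\alpha/\beta$ and $\delta/\beta$ nonincreasing, and $$\min\Big\{\inf_{t\ge0}\tfrac{\alpha(t)}{\beta(t)},\ \inf_{t\ge0}\tfrac{\delta(t)}{\beta(t)}\Big\}>\|A\|.$$ Let $(x,y):[0,\infty)\to\mathcal X\times\mathcal Y$ be absolutely continuous on compact intervals, differentiable at almost every $t>0$, and such that for almost every $t>0$ $$X(t):=-\alpha(t)\dot x(t)-\beta(t)A^*\dot y(t)-A^*y(t)\in\partial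 f(x(t)),\qquad Y(t):=-\beta(t)A\dot x(t)-\delta(t)\dot y(t)+Ax(t)\in\partial g^*(y(t)).$$ For $u\in\mathcal X$, $v\in\mathcal Y$ set $$\mathcal E^S_{u,v}(t)=\frac{\alpha(t)}{2\beta(t)}\|x(t)-u\|^2+\frac{\delta(t)}{2\beta(t)}\|y(t)-v\|^2+\langle A(x(t)-u),y(t)-v\rangle,$$ $$d_{u,v}(t)=\big[f(u)-f(x(t))-\langle X(t),u-x(t)\rangle\big]+\big[g^*(v)-g^*(y(t))-\langle Y(t),v-y(t)\rangle\big],$$ and for $t>0$ let $$\hat x(t)=\Big(\int_0^t\tfrac{ds}{\beta(s)}\Big)^{-1}\int_0^t\frac{x(s)}{\beta(s)}\,ds,\qquad \hat y(t)=\Big(\int_0^t\tfrac{ds}{\beta(s)}\Big)^{-1}\int_0^t\frac{y(s)}{\beta(s)}\,ds,\qquad \hat\Delta_{u,v}(t)=L(\hat x(t),v)-L(u,\hat y(t)).$$ A weak subsequential limit point of a trajectory is a weak limit of the trajectory along some sequence $t_k\to+\infty$. Then: i) If $\mathcal S\ne\emptyset$, then $(x,y)$ and $(\hat x,\hat y)$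 are bounded, and both have weak subsequential limit points. ii) For every $(u,v)\in\mathcal X\times\mathcal Y$ and every $t>0$, $\hat\Delta_{u,v}(t)\le\Big(\int_0^t\frac{ds}{\beta(s)}\Big)^{-1}\mathcal E^S_{u,v}(0)$. iii) For every $(\bar x,\bar y)\in\mathcal S$, $d_{\bar x,\bar y}$ is finite and nonnegative almost everywhere on $(0,\infty)$, $\frac1\beta d_{\bar x,\bar y}$ is integrable on $(0,\infty)$, and $\int_0^t\frac{d_{\bar x,\bar y}(s)}{\beta(s)}\,ds\le\mathcal E^S_{\bar x,\bar y}(0)$ for every $t\ge0$. iv) If $1/\beta\notin L^1(0,\infty)$, then every weak subsequential limit point of $(\hat x,\hat y)$ belongs to $\mathcal S$. v) If $1/\beta\notin L^1(0,\infty)$ and either $\alpha/\beta$ and $\delta/\beta$ are constant and $\mathcal S\neq\emptyset$, or $\mathcal S$ consists of exactly one point, then $(\hat x(t),\hat y(t))$ converges weakly, as $t\to+\infty$, to a point of $\mathcal S$. -/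

import Mathlib

open Set Filter Topology MeasureTheory

namespace PrimalDual

section Convex

variable {E : Type*} [NormedAddCommGroup E] [InnerProductSpace ℝ E]

/-- The class `Γ₀(E)`: proper, convex (convex epigraph), lower semicontinuous functions with values
in `(-∞, +∞]`. -/
structure GammaZero (f : E → EReal) : Prop where
  ne_bot : ∀ x, f x ≠ ⊥
  exists_ne_top : ∃ x, f x ≠ ⊤
  convex_epigraph : Convex ℝ {p : E × ℝ | f p.1 ≤ (p.2 : EReal)}
  lsc : LowerSemicontinuous f

/-- The Fenchel conjugate `g*(y) = sup_z (⟨y, z⟩ - g z)`. -/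
noncomputable def conjugate (g : E → EReal) (y : E) : EReal :=
  ⨆ z : E, ((inner ℝ y z : ℝ) : EReal) - g z

/-- The (Fenchel) subdifferential of `f` at `x`; it is empty where `f` is not finite. -/
def subdifferential (f : E → EReal) (x : E) : Set E :=
  {p | f x ≠ ⊥ ∧ f x ≠ ⊤ ∧ ∀ u : E, f x + ((inner ℝ p (u - x) : ℝ) : EReal) ≤ f u}

/-- Weak convergence of `z` to `p` along the filter `l`. -/
def TendstoWeakly {ι : Type*} (z : ι → E) (l : Filter ι) (p : E) : Prop :=
  Tendsto (fun i => toWeakSpace ℝ E (z i)) l (𝓝 (toWeakSpace ℝ E p))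

/-- `z : [0, ∞) → E` is absolutely continuous on every compact subinterval of `[0, ∞)`. -/
def LocallyAbsCont (z : ℝ → E) : Prop :=
  ∀ T : ℝ, 0 ≤ T → AbsolutelyContinuousOnInterval z 0 T

/-- The ergodic average `(∫₀ᵗ ds/β(s))⁻¹ ∫₀ᵗ z(s)/β(s) ds`, meaningful for `t > 0`. -/
noncomputable def ergodic (β : ℝ → ℝ) (z : ℝ → E) (t : ℝ) : E :=
  (∫ s in (0 : ℝ)..t, 1 / β s)⁻¹ • ∫ s in (0 : ℝ)..t, (1 / β s) • z s

end Convex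

section System

variable {X Y : Type*} [NormedAddCommGroup X] [InnerProductSpace ℝ X] [CompleteSpace X]
  [NormedAddCommGroup Y] [InnerProductSpace ℝ Y] [CompleteSpace Y]

/-- Weak subsequential limit points of `(x(t), y(t))` as `t → +∞`. (The weak topology of the
product is the product of the weak topologies.) -/
def weakLimitPoints (x : ℝ → X) (y : ℝ → Y) : Set (X × Y) :=
  {p | ∃ τ : ℕ → ℝ, Tendsto τ atTop atTop ∧
    TendstoWeakly (fun k => x (τ k)) atTop p.1 ∧ TendstoWeakly (fun k => y (τ k)) atTop p.2}

/-- The set of primal-dual solutions of `min_x f(x) + g(Ax)`: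
pairs with `-A* ȳ ∈ ∂f(x̄)` and `A x̄ ∈ ∂g*(ȳ)`. -/
def solutions (f : X → EReal) (g : Y → EReal) (A : X →L[ℝ] Y) : Set (X × Y) :=
  {p | -(A.adjoint p.2) ∈ subdifferential f p.1 ∧ A p.1 ∈ subdifferential (conjugate g) p.2}

/-- The Lagrangian `L(u, v) = f(u) + ⟨v, A u⟩ - g*(v)`. It is `+∞` if `f(u) = +∞ > g*(v)`, and `-∞`
if `g*(v) = +∞`. -/
noncomputable def lagrangian (f : X → EReal) (g : Y → EReal) (A : X →L[ℝ] Y)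
    (u : X) (v : Y) : EReal :=
  f u + ((inner ℝ v (A u) : ℝ) : EReal) - conjugate g v

/-- `X(t) = -α(t) ẋ(t) - β(t) A* ẏ(t) - A* y(t)`. -/
noncomputable def primalSelection (A : X →L[ℝ] Y) (α β : ℝ → ℝ) (x : ℝ → X) (y : ℝ → Y)
    (t : ℝ) : X :=
  -(α t • deriv x t) - β t • A.adjoint (deriv y t) - A.adjoint (y t)

/-- `Y(t) = -γ(t) A ẋ(t) - δ(t) ẏ(t) + A x(t)`. -/
noncomputable def dualSelection (A : X →L[ℝ] Y) (γ δ : ℝ → ℝ) (x : ℝ → X) (y : ℝ → Y)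
    (t : ℝ) : Y :=
  -(γ t • A (deriv x t)) - δ t • deriv y t + A (x t)

/-- `(x, y)` is a (strong) solution on `[0, ∞)` of the preconditioned system
`α ẋ + β A* ẏ + ∂f(x) + A* y ∋ 0`, `γ A ẋ + δ ẏ - A x + ∂g*(y) ∋ 0`: it is locally absolutely
continuous, and at almost every `t > 0` it is differentiable and satisfies both inclusions. -/
structure IsTrajectory (f : X → EReal) (g : Y → EReal) (A : X →L[ℝ] Y)
    (α β γ δ : ℝ → ℝ) (x : ℝ → X) (y : ℝ → Y) : Prop where
  locallyAbsCont_x : LocallyAbsCont x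
  locallyAbsCont_y : LocallyAbsCont y
  inclusion : ∀ᵐ t ∂(volume.restrict (Ioi (0 : ℝ))),
    DifferentiableAt ℝ x t ∧ DifferentiableAt ℝ y t ∧
      primalSelection A α β x y t ∈ subdifferential f (x t) ∧
      dualSelection A γ δ x y t ∈ subdifferential (conjugate g) (y t)

/-- The Bregman divergence `d_{u,v}(t)`: the sum of `f(u) - f(x(t)) - ⟨X(t), u - x(t)⟩` and
`g*(v) - g*(y(t)) - ⟨Y(t), v - y(t)⟩`. -/
noncomputable def bregman (f : X → EReal) (g : Y → EReal) (A : X →L[ℝ] Y)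
    (α β γ δ : ℝ → ℝ) (x : ℝ → X) (y : ℝ → Y) (u : X) (v : Y) (t : ℝ) : EReal :=
  (f u - f (x t) - ((inner ℝ (primalSelection A α β x y t) (u - x t) : ℝ) : EReal)) +
    (conjugate g v - conjugate g (y t) -
      ((inner ℝ (dualSelection A γ δ x y t) (v - y t) : ℝ) : EReal))

/-- The energy `(α/β)(t)/2 ‖x(t) - u‖² + (δ/β)(t)/2 ‖y(t) - v‖² + ⟨A(x(t) - u), y(t) - v⟩`. -/
noncomputable def energy (A : X →L[ℝ] Y) (α β δ : ℝ → ℝ) (x : ℝ → X) (y : ℝ → Y)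
    (u : X) (v : Y) (t : ℝ) : ℝ :=
  (α t / β t) / 2 * ‖x t - u‖ ^ 2 + (δ t / β t) / 2 * ‖y t - v‖ ^ 2 +
    inner ℝ (A (x t - u)) (y t - v)

end System

end PrimalDual

open PrimalDual

/-! Because the same β multiplies both coupling terms of the system, testing the inclusions against
x - u and y - v produces an exact derivative. With G(t) = L(x(t), v) - L(u, y(t)), the quantity
`gapRate` equals (G + d)/β whenever f(u) and g*(v) are finite, and `gapRate_eq` shows that it is
also -Ė plus two terms that are nonpositive since α/β and δ/β decrease. The condition on ‖A‖ makes
the energy E coercive (`exists_coercive`), so the integral of `gapRate` over [0, t] is at most E(0).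

The subgradient inequalities give d ≥ 0, and Jensen's inequality turns the integrated bound on G/β
into the ergodic estimate (`ergodic_gap`). At a solution G ≥ 0 as well; hence E decreases, the
trajectory is bounded, and d/β is integrable.

If 1/β has infinite mass, the ergodic gap has a nonpositive limit superior. Weak lower
semicontinuity then makes every weak limit point of the averages a saddle point
(`weakLimitPoints_subset`). For constant ratios an Opial argument gives uniqueness: the energies
centred at two limit points differ by an affine function of (x, y), so its averages converge, and
coercivity forces the two points to coincide (`weakLimitPoints_subsingleton`). -/

/-! ### Operations preserving absolute continuity -/

section AbsolutelyContinuous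

variable {V W : Type*} [PseudoMetricSpace V] [PseudoMetricSpace W]

/-- Postcomposition with a Lipschitz map preserves absolute continuity. -/
theorem AbsolutelyContinuousOnInterval.lipschitzOnWith_comp {φ : V → W} {z : ℝ → V} {a b : ℝ}
    {K : NNReal} {s : Set V} (hφ : LipschitzOnWith K φ s)
    (hz : AbsolutelyContinuousOnInterval z a b) (hs : MapsTo z (uIcc a b) s) :
    AbsolutelyContinuousOnInterval (fun t => φ (z t)) a b := by
  rw [absolutelyContinuousOnInterval_iff] at hz ⊢
  intro ε hε
  obtain ⟨δ, hδ, h⟩ := hz (ε / (K + 1)) (by positivity)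
  refine ⟨δ, hδ, fun E hE hlt => ?_⟩
  have h1 := h E hE hlt
  rw [lt_div_iff₀ (by positivity)] at h1
  refine lt_of_le_of_lt ?_ h1
  rw [Finset.sum_mul]
  refine Finset.sum_le_sum fun i hi => ?_
  have h2 := hφ.dist_le_mul _ (hs (hE.1 i hi).1) _ (hs (hE.1 i hi).2)
  nlinarith [dist_nonneg (x := z (E.2 i).1) (y := z (E.2 i).2)]

/-- By compactness z has a positive minimum c on the interval, and inversion is Lipschitz on [c, ∞)
with constant 1/c². -/
theorem AbsolutelyContinuousOnInterval.inv_of_pos {z : ℝ → ℝ} {a b : ℝ}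
    (hz : AbsolutelyContinuousOnInterval z a b) (hpos : ∀ t ∈ uIcc a b, 0 < z t) :
    AbsolutelyContinuousOnInterval (fun t => (z t)⁻¹) a b := by
  obtain ⟨t₀, ht₀, hmin⟩ := isCompact_uIcc.exists_isMinOn nonempty_uIcc hz.continuousOn
  have hc := hpos t₀ ht₀
  have hlip : LipschitzOnWith (Real.toNNReal ((z t₀ * z t₀)⁻¹)) (fun r : ℝ => r⁻¹)
      (Ici (z t₀)) := by
    refine LipschitzOnWith.of_dist_le_mul fun r hr q hq => ?_
    have hr' : 0 < r := hc.trans_le hr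
    have hq' : 0 < q := hc.trans_le hq
    rw [Real.coe_toNNReal _ (by positivity), Real.dist_eq, Real.dist_eq,
      inv_sub_inv hr'.ne' hq'.ne', abs_div, abs_of_pos (mul_pos hr' hq'), abs_sub_comm,
      div_eq_inv_mul]
    gcongr
    · exact hr
    · exact hq
  exact hz.lipschitzOnWith_comp hlip fun t ht => hmin ht

theorem AbsolutelyContinuousOnInterval.norm_sq {E : Type*} [NormedAddCommGroup E] {z : ℝ → E}
    {a b : ℝ} (hz : AbsolutelyContinuousOnInterval z a b) :
    AbsolutelyContinuousOnInterval (fun t => ‖z t‖ ^ 2) a b := by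
  have h := hz.lipschitzOnWith_comp lipschitzWith_one_norm.lipschitzOnWith (mapsTo_univ _ _)
  simpa only [sq] using! h.fun_mul h

theorem AbsolutelyContinuousOnInterval.inner {E : Type*} [NormedAddCommGroup E]
    [InnerProductSpace ℝ E] {z w : ℝ → E} {a b : ℝ}
    (hz : AbsolutelyContinuousOnInterval z a b) (hw : AbsolutelyContinuousOnInterval w a b) :
    AbsolutelyContinuousOnInterval (fun t => inner ℝ (z t) (w t)) a b := by
  -- Polarization reduces the inner product to squared norms.
  have h := (((hz.fun_add hw).norm_sq.fun_sub hz.norm_sq).fun_sub hw.norm_sq).const_mul (1 / 2)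
  convert! h using 2 with t
  simp only [norm_add_sq_real]
  ring

theorem absolutelyContinuousOnInterval_const {a b : ℝ} (c : V) :
    AbsolutelyContinuousOnInterval (fun _ => c) a b :=
  ((LipschitzWith.const c).lipschitzOnWith (s := uIcc a b)).absolutelyContinuousOnInterval

end AbsolutelyContinuous

/-! ### Weak convergence in Hilbert spaces -/

section WeakConvergence

variable {E : Type*} [NormedAddCommGroup E] [InnerProductSpace ℝ E]

theorem PrimalDual.TendstoWeakly.inner_tendsto {ι : Type*} {z : ι → E} {l : Filter ι} {p : E}
    (h : TendstoWeakly z l p) (w : E) :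
    Tendsto (fun i => inner ℝ w (z i)) l (𝓝 (inner ℝ w p)) :=
  (((WeakBilin.eval_continuous (topDualPairing ℝ E).flip (innerSL ℝ w)).tendsto _).comp h)

theorem tendstoWeakly_iff_inner [CompleteSpace E] {ι : Type*} {z : ι → E} {l : Filter ι} {p : E} :
    TendstoWeakly z l p ↔ ∀ w, Tendsto (fun i => inner ℝ w (z i)) l (𝓝 (inner ℝ w p)) := by
  refine ⟨fun h w => h.inner_tendsto w, fun h => ?_⟩
  have hinj : Function.Injective (topDualPairing ℝ E).flip := by
    intro a b hab
    refine ext_inner_left ℝ fun v => ?_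
    exact DFunLike.congr_fun hab (innerSL ℝ v)
  refine (WeakBilin.tendsto_iff_forall_eval_tendsto _ hinj).2 fun ψ => ?_
  have h1 := h ((InnerProductSpace.toDual ℝ E).symm ψ)
  simp only [InnerProductSpace.toDual_symm_apply] at h1
  exact h1

theorem PrimalDual.TendstoWeakly.comp {ι κ : Type*} {z : ι → E} {l : Filter ι} {p : E}
    (h : TendstoWeakly z l p) {σ : κ → ι} {m : Filter κ} (hσ : Tendsto σ m l) :
    TendstoWeakly (fun k => z (σ k)) m p :=
  Tendsto.comp (g := fun i => toWeakSpace ℝ E (z i)) h hσ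

/-- Bounded sequences in a Hilbert space have weakly convergent subsequences. -/
theorem exists_subseq_tendstoWeakly [CompleteSpace E] {z : ℕ → E} {C : ℝ} (hz : ∀ n, ‖z n‖ ≤ C) :
    ∃ p : E, ∃ σ : ℕ → ℕ, StrictMono σ ∧ TendstoWeakly (fun k => z (σ k)) atTop p := by
  -- The closed span of the sequence is separable, as the sequential Banach–Alaoglu theorem
  -- requires.
  let K : Submodule ℝ E := (Submodule.span ℝ (range z)).topologicalClosure
  have hzK : ∀ n, z n ∈ K := fun n =>
    Submodule.le_topologicalClosure _ (Submodule.subset_span (mem_range_self n))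
  have : CompleteSpace K := (Submodule.isClosed_topologicalClosure _).completeSpace_coe
  have : TopologicalSpace.SeparableSpace K := by
    have h : TopologicalSpace.IsSeparable (K : Set E) := by
      have h0 : TopologicalSpace.IsSeparable (range z) := (countable_range z).isSeparable
      exact h0.span.closure
    exact h.separableSpace
  let zK : ℕ → K := fun n => ⟨z n, hzK n⟩
  let ψ : ℕ → WeakDual ℝ K := fun n => StrongDual.toWeakDual (InnerProductSpace.toDual ℝ K (zK n))
  have hψ : ∀ n, ψ n ∈ WeakDual.toStrongDual ⁻¹' Metric.closedBall (0 : StrongDual ℝ K) C := by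
    intro n
    refine (mem_closedBall_zero_iff (E := StrongDual ℝ K)).2 ?_
    exact ((InnerProductSpace.toDual ℝ K).norm_map (zK n)).trans_le (hz n)
  obtain ⟨q, -, σ, hσ, hlim⟩ := WeakDual.isSeqCompact_closedBall ℝ K 0 C hψ
  refine ⟨((InnerProductSpace.toDual ℝ K).symm (WeakDual.toStrongDual q) : K), σ, hσ,
    tendstoWeakly_iff_inner.2 fun w => ?_⟩
  have h1 := ((WeakDual.eval_continuous (K.orthogonalProjectionOnto w)).tendsto q).comp hlim
  -- Vectors of K see a test vector w only through its projection onto K, so weak convergence in K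
  -- passes to E.
  have key : ∀ k : K, inner ℝ w (k : E) = inner ℝ k (K.orthogonalProjectionOnto w) := by
    intro k
    rw [real_inner_comm, Submodule.coe_inner]
    have := Submodule.inner_orthogonalProjectionOnto_eq_of_mem_left k w
    exact this.symm
  rw [key, InnerProductSpace.toDual_symm_apply]
  refine h1.congr fun k => ?_
  exact (key (zK (σ k))).symm

/-- A convex lower semicontinuous function is sequentially weakly lower semicontinuous. -/
theorem PrimalDual.GammaZero.eventually_lt_of_tendstoWeakly {f : E → EReal} (hf : GammaZero f)
    {ι : Type*} {z : ι → E} {l : Filter ι} {p : E} (h : TendstoWeakly z l p) {r : ℝ}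
    (hr : (r : EReal) < f p) : ∀ᶠ i in l, (r : EReal) < f (z i) := by
  let s : Set E := {x | f x ≤ r}
  have hconv : Convex ℝ s := by
    intro a ha b hb c d hc hd hcd
    have := hf.convex_epigraph (x := (a, r)) ha (y := (b, r)) hb hc hd hcd
    simpa [s, ← add_mul, hcd] using this
  have hclosed : IsClosed s := hf.lsc.isClosed_preimage r
  -- Mazur: a closed convex sublevel set is weakly closed.
  have hw : IsClosed (toWeakSpace ℝ E '' s) := by
    have := hconv.toWeakSpace_closure ℝ
    rw [hclosed.closure_eq] at this
    rw [this]
    exact isClosed_closure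
  have hp : toWeakSpace ℝ E p ∈ (toWeakSpace ℝ E '' s)ᶜ := by
    rintro ⟨q, hq, hqp⟩
    rw [(toWeakSpace ℝ E).injective hqp] at hq
    exact absurd hr (not_lt.2 hq)
  filter_upwards [h (hw.isOpen_compl.mem_nhds hp)] with i hi
  by_contra hcon
  exact hi ⟨z i, not_lt.1 hcon, rfl⟩

end WeakConvergence

/-! ### Weighted averages -/

section WeightedAverages

/-- Weighted averages stay in closed convex sets. -/
theorem Convex.weighted_average_mem {V : Type*} [NormedAddCommGroup V] [NormedSpace ℝ V]
    [CompleteSpace V] {C : Set V} (hC : Convex ℝ C) (hclosed : IsClosed C) {w : ℝ → ℝ}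
    {φ : ℝ → V} {t : ℝ} (ht : 0 ≤ t) (hw : IntervalIntegrable w volume 0 t)
    (hw0 : ∀ᵐ s ∂volume.restrict (Ioc 0 t), 0 ≤ w s) (hW : 0 < ∫ s in (0 : ℝ)..t, w s)
    (hφ : IntervalIntegrable (fun s => w s • φ s) volume 0 t)
    (hmem : ∀ᵐ s ∂volume.restrict (Ioc 0 t), φ s ∈ C) :
    (∫ s in (0 : ℝ)..t, w s)⁻¹ • ∫ s in (0 : ℝ)..t, w s • φ s ∈ C := by
  -- A functional strictly separating the average from C would contradict the integral of its
  -- pointwise bound on C.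
  by_contra hcon
  obtain ⟨ℓ, u, h1, h2⟩ := geometric_hahn_banach_closed_point hC hclosed hcon
  rw [map_smul, smul_eq_mul, ← ContinuousLinearMap.intervalIntegral_comp_comm _ hφ,
    ← div_eq_inv_mul, lt_div_iff₀ hW, ← intervalIntegral.integral_const_mul] at h2
  refine absurd h2 (not_lt.2 ?_)
  refine intervalIntegral.integral_mono_ae_restrict ht ?_ (hw.const_mul u) ?_
  · rw [intervalIntegrable_iff] at hφ ⊢
    exact ℓ.integrable_comp hφ
  · rw [Filter.EventuallyLE, ← restrict_Ioc_eq_restrict_Icc]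
    filter_upwards [hw0, hmem] with s hs hm
    rw [map_smul, smul_eq_mul, mul_comm u]
    exact mul_le_mul_of_nonneg_left (h1 _ hm).le hs

/-- Cesàro averaging with a nonnegative weight of infinite mass preserves limits. -/
theorem tendsto_weighted_average {w φ : ℝ → ℝ} {m : ℝ}
    (hw : ∀ T, 0 ≤ T → IntervalIntegrable w volume 0 T) (hw0 : ∀ t, 0 ≤ t → 0 ≤ w t)
    (hW : Tendsto (fun t => ∫ s in (0 : ℝ)..t, w s) atTop atTop)
    (hφ : ∀ T, 0 ≤ T → IntervalIntegrable (fun s => w s * φ s) volume 0 T)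
    (hm : Tendsto φ atTop (𝓝 m)) :
    Tendsto (fun t => (∫ s in (0 : ℝ)..t, w s)⁻¹ * ∫ s in (0 : ℝ)..t, w s * φ s) atTop (𝓝 m) := by
  rw [Metric.tendsto_atTop] at hm ⊢
  intro ε hε
  obtain ⟨T₀, hT₀⟩ := hm (ε / 2) (by positivity)
  set T := max T₀ 0
  have hT : 0 ≤ T := le_max_right _ _
  set c : ℝ := |∫ s in (0 : ℝ)..T, w s * (φ s - m)|
  -- Past T the deviation is below ε/2; the fixed head c contributes less than ε/2 once the mass
  -- exceeds 2c/ε.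
  obtain ⟨T₁, hT₁⟩ := eventually_atTop.1 (hW.eventually_gt_atTop (2 * c / ε))
  refine ⟨max T₁ T, fun t ht => ?_⟩
  have htT : T ≤ t := (le_max_right _ _).trans ht
  have ht0 : 0 ≤ t := hT.trans htT
  have hWt := hT₁ t ((le_max_left _ _).trans ht)
  have hWpos : 0 < ∫ s in (0 : ℝ)..t, w s := lt_of_le_of_lt (by positivity) hWt
  have hi : ∀ S, 0 ≤ S → IntervalIntegrable (fun s => w s * (φ s - m)) volume 0 S := by
    intro S hS
    simpa only [mul_sub] using! (hφ S hS).sub ((hw S hS).mul_const m)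
  have hsub : IntervalIntegrable w volume T t := (hw T hT).symm.trans (hw t ht0)
  have hsplit : ∫ s in (0 : ℝ)..t, w s * (φ s - m) =
      (∫ s in (0 : ℝ)..T, w s * (φ s - m)) + ∫ s in T..t, w s * (φ s - m) :=
    (intervalIntegral.integral_add_adjacent_intervals (hi T hT)
      ((hi T hT).symm.trans (hi t ht0))).symm
  have htail : |∫ s in T..t, w s * (φ s - m)| ≤ ε / 2 * ∫ s in (0 : ℝ)..t, w s := by
    have h1 : |∫ s in T..t, w s * (φ s - m)| ≤ ∫ s in T..t, ε / 2 * w s := by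
      rw [← Real.norm_eq_abs]
      refine intervalIntegral.norm_integral_le_of_norm_le htT ?_ (hsub.const_mul _)
      refine Eventually.of_forall fun s hs => ?_
      have h2 := hT₀ s ((le_max_left _ _).trans hs.1.le)
      rw [Real.dist_eq] at h2
      have h3 := hw0 s (hT.trans hs.1.le)
      rw [Real.norm_eq_abs, abs_mul, abs_of_nonneg h3, mul_comm]
      exact mul_le_mul_of_nonneg_right h2.le h3
    rw [intervalIntegral.integral_const_mul] at h1
    have h4 : ∫ s in (0 : ℝ)..t, w s = (∫ s in (0 : ℝ)..T, w s) + ∫ s in T..t, w s :=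
      (intervalIntegral.integral_add_adjacent_intervals (hw T hT) hsub).symm
    have h5 : 0 ≤ ∫ s in (0 : ℝ)..T, w s :=
      intervalIntegral.integral_nonneg hT fun s hs => hw0 s hs.1
    refine h1.trans ?_
    gcongr
    linarith
  have heq : (∫ s in (0 : ℝ)..t, w s)⁻¹ * (∫ s in (0 : ℝ)..t, w s * φ s) - m =
      (∫ s in (0 : ℝ)..t, w s * (φ s - m)) / ∫ s in (0 : ℝ)..t, w s := by
    have : ∫ s in (0 : ℝ)..t, w s * (φ s - m) =
        (∫ s in (0 : ℝ)..t, w s * φ s) - (∫ s in (0 : ℝ)..t, w s) * m := by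
      rw [← intervalIntegral.integral_mul_const, ← intervalIntegral.integral_sub (hφ t ht0)
        ((hw t ht0).mul_const m)]
      simp only [mul_sub]
    rw [this]
    field_simp
  rw [Real.dist_eq, heq, abs_div, abs_of_pos hWpos, div_lt_iff₀ hWpos, hsplit]
  have h6 := abs_add_le (∫ s in (0 : ℝ)..T, w s * (φ s - m)) (∫ s in T..t, w s * (φ s - m))
  rw [div_lt_iff₀ hε] at hWt
  linarith

end WeightedAverages

/-! ### Convex functions, Jensen's inequality, local absolute continuity -/

namespace PrimalDual

section Convex

variable {E : Type*} [NormedAddCommGroup E] [InnerProductSpace ℝ E]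

theorem GammaZero.isClosed_epigraph {f : E → EReal} (hf : GammaZero f) :
    IsClosed {p : E × ℝ | f p.1 ≤ (p.2 : EReal)} := by
  have h := hf.lsc.isClosed_epigraph
  exact h.preimage (f := fun p : E × ℝ => (p.1, (p.2 : EReal)))
    (continuous_fst.prodMk (continuous_coe_real_ereal.comp continuous_snd))

theorem GammaZero.coe_toReal {f : E → EReal} (hf : GammaZero f) {x : E} (hx : f x ≠ ⊤) :
    ((f x).toReal : EReal) = f x :=
  EReal.coe_toReal hx (hf.ne_bot x)

/-- The Fenchel conjugate of a proper function is again in `Γ₀` as soon as it is finite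
somewhere. -/
theorem gammaZero_conjugate {g : E → EReal} (hg : GammaZero g) {v : E} (hv : conjugate g v ≠ ⊤) :
    GammaZero (conjugate g) where
  ne_bot y := by
    obtain ⟨z, hz⟩ := hg.exists_ne_top
    have h : ((inner ℝ y z : ℝ) : EReal) - g z ≤ conjugate g y :=
      le_iSup (fun z => ((inner ℝ y z : ℝ) : EReal) - g z) z
    rw [← hg.coe_toReal hz, ← EReal.coe_sub] at h
    exact ne_bot_of_le_ne_bot (EReal.coe_ne_bot _) h
  exists_ne_top := ⟨v, hv⟩
  convex_epigraph := by
    intro p hp q hq a b ha hb hab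
    simp only [conjugate, mem_ofPred_eq, iSup_le_iff] at hp hq ⊢
    intro z
    by_cases hz : g z = ⊤
    · simp [hz]
    have h1 := hp z
    have h2 := hq z
    rw [← hg.coe_toReal hz, ← EReal.coe_sub, EReal.coe_le_coe_iff] at h1 h2 ⊢
    simp only [Prod.fst_add, Prod.smul_fst, Prod.snd_add, Prod.smul_snd, inner_add_left,
      real_inner_smul_left, smul_eq_mul]
    have hc : (g z).toReal = a * (g z).toReal + b * (g z).toReal := by rw [← add_mul, hab, one_mul]
    linarith [mul_le_mul_of_nonneg_left h1 ha, mul_le_mul_of_nonneg_left h2 hb]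
  lsc := by
    refine lowerSemicontinuous_iSup fun z => ?_
    by_cases hz : g z = ⊤
    · simpa [hz] using lowerSemicontinuous_const
    rw [← hg.coe_toReal hz]
    simp only [← EReal.coe_sub]
    refine Continuous.lowerSemicontinuous (continuous_coe_real_ereal.comp ?_)
    fun_prop

theorem toReal_add_inner_le_of_mem_subdifferential {f : E → EReal} {x p u : E}
    (hp : p ∈ subdifferential f x) (hu : f u ≠ ⊤) :
    (f x).toReal + inner ℝ p (u - x) ≤ (f u).toReal := by
  have h := hp.2.2 u
  have hub : f u ≠ ⊥ := by
    intro hb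
    rw [hb, ← EReal.coe_toReal hp.2.1 hp.1, ← EReal.coe_add, le_bot_iff] at h
    exact EReal.coe_ne_bot _ h
  rwa [← EReal.coe_toReal hp.2.1 hp.1, ← EReal.coe_add, ← EReal.coe_toReal hu hub,
    EReal.coe_le_coe_iff] at h

/-- Jensen's inequality for ergodic averages. -/
theorem GammaZero.ergodic_le [CompleteSpace E] {f : E → EReal} (hf : GammaZero f) {β : ℝ → ℝ}
    {z : ℝ → E} {φ : ℝ → ℝ} {t : ℝ} (ht : 0 ≤ t)
    (hβ : IntervalIntegrable (fun s => 1 / β s) volume 0 t)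
    (hβ0 : ∀ s, 0 ≤ s → 0 ≤ 1 / β s) (hW : 0 < ∫ s in (0 : ℝ)..t, 1 / β s)
    (hz : IntervalIntegrable (fun s => (1 / β s) • z s) volume 0 t)
    (hφ : IntervalIntegrable (fun s => 1 / β s * φ s) volume 0 t)
    (hle : ∀ᵐ s ∂volume.restrict (Ioc 0 t), f (z s) ≤ φ s) :
    f (ergodic β z t) ≤
      (((∫ s in (0 : ℝ)..t, 1 / β s)⁻¹ * ∫ s in (0 : ℝ)..t, 1 / β s * φ s : ℝ) : EReal) := by
  -- The pairs (z, φ) lie in the closed convex epigraph almost everywhere, hence so does their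
  -- average.
  have hi : IntervalIntegrable (fun s => (1 / β s) • (z s, φ s)) volume 0 t := by
    rw [intervalIntegrable_iff] at hz hφ ⊢
    exact hz.prodMk hφ
  have h := hf.convex_epigraph.weighted_average_mem hf.isClosed_epigraph ht hβ
    ((ae_restrict_mem measurableSet_Ioc).mono fun s hs => hβ0 s hs.1.le) hW hi hle
  have h1 : (∫ s in (0 : ℝ)..t, (1 / β s) • (z s, φ s)).1 = ∫ s in (0 : ℝ)..t, (1 / β s) • z s :=
    ((ContinuousLinearMap.fst ℝ E ℝ).intervalIntegral_comp_comm hi).symm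
  have h2 : (∫ s in (0 : ℝ)..t, (1 / β s) • (z s, φ s)).2 = ∫ s in (0 : ℝ)..t, 1 / β s * φ s :=
    ((ContinuousLinearMap.snd ℝ E ℝ).intervalIntegral_comp_comm hi).symm
  simp only [mem_ofPred_eq, Prod.smul_fst, Prod.smul_snd, h1, h2, smul_eq_mul] at h
  exact h

omit [InnerProductSpace ℝ E] in
theorem LocallyAbsCont.continuousOn {z : ℝ → E} (hz : LocallyAbsCont z) :
    ContinuousOn z (Ici 0) := by
  intro t ht
  have ht' : (0 : ℝ) ≤ t := ht
  have h := (hz (t + 1) (by linarith)).continuousOn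
  rw [uIcc_of_le (by linarith)] at h
  refine (h t ⟨ht, by linarith⟩).mono_of_mem_nhdsWithin ?_
  rw [← Ici_inter_Iic]
  exact inter_mem_nhdsWithin _ (Iic_mem_nhds (by linarith))

theorem LocallyAbsCont.ae_differentiableAt {z : ℝ → ℝ} (hz : LocallyAbsCont z) :
    ∀ᵐ t ∂volume.restrict (Ioi (0 : ℝ)), DifferentiableAt ℝ z t := by
  rw [ae_restrict_iff' measurableSet_Ioi]
  have h : ∀ᵐ t : ℝ, ∀ n : ℕ, t ∈ uIcc (0 : ℝ) n → DifferentiableAt ℝ z t :=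
    ae_all_iff.2 fun n => (hz n n.cast_nonneg).ae_differentiableAt
  filter_upwards [h] with t ht ht0
  obtain ⟨n, hn⟩ := exists_nat_ge t
  exact ht n (by rw [uIcc_of_le n.cast_nonneg]; exact ⟨(mem_Ioi.1 ht0).le, hn⟩)

omit [InnerProductSpace ℝ E] in
theorem LocallyAbsCont.mono {z : ℝ → E} (hz : LocallyAbsCont z) {S T : ℝ} (hS : 0 ≤ S)
    (hT : S ≤ T) : AbsolutelyContinuousOnInterval z S T := by
  refine (hz T (hS.trans hT)).mono ?_
  rw [uIcc_of_le hT, uIcc_of_le (hS.trans hT)]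
  exact Icc_subset_Icc_left hS

theorem LocallyAbsCont.intervalIntegrable_deriv {z : ℝ → ℝ} (hz : LocallyAbsCont z) {S T : ℝ}
    (hS : 0 ≤ S) (hT : S ≤ T) : IntervalIntegrable (deriv z) volume S T :=
  (hz.mono hS hT).intervalIntegrable_deriv

end Convex

theorem deriv_nonpos_of_antitoneOn_Ici {σ : ℝ → ℝ} (hσ : AntitoneOn σ (Ici 0)) {t : ℝ}
    (ht : 0 < t) : deriv σ t ≤ 0 := by
  rw [← derivWithin_of_mem_nhds (Ici_mem_nhds ht)]
  exact hσ.derivWithin_nonpos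

/-! ### The energy identity -/

section Flow

variable {X Y : Type*} [NormedAddCommGroup X] [InnerProductSpace ℝ X] [CompleteSpace X]
  [NormedAddCommGroup Y] [InnerProductSpace ℝ Y] [CompleteSpace Y]

/-- A trajectory of the preconditioned primal-dual system with admissible coefficients. -/
structure IsSaddleFlow (f : X → EReal) (g : Y → EReal) (A : X →L[ℝ] Y) (α β δ : ℝ → ℝ)
    (x : ℝ → X) (y : ℝ → Y) : Prop where
  gammaZero_primal : GammaZero f
  gammaZero_dual : GammaZero g
  absCont_α : LocallyAbsCont α
  absCont_β : LocallyAbsCont β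
  absCont_δ : LocallyAbsCont δ
  β_pos : ∀ t, 0 ≤ t → 0 < β t
  antitone_α : AntitoneOn (fun t => α t / β t) (Ici 0)
  antitone_δ : AntitoneOn (fun t => δ t / β t) (Ici 0)
  norm_lt : ‖A‖ < min (⨅ t : Ici (0 : ℝ), α t / β t) (⨅ t : Ici (0 : ℝ), δ t / β t)
  trajectory : IsTrajectory f g A α β β δ x y

/-- The density whose time integral bounds the Lagrangian gap. -/
noncomputable def gapRate (A : X →L[ℝ] Y) (α β δ : ℝ → ℝ) (x : ℝ → X) (y : ℝ → Y)
    (u : X) (v : Y) (t : ℝ) : ℝ :=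
  1 / β t * (inner ℝ (primalSelection A α β x y t) (x t - u) +
    inner ℝ (dualSelection A β δ x y t) (y t - v) + inner ℝ v (A (x t)) - inner ℝ (y t) (A u))

variable {f : X → EReal} {g : Y → EReal} {A : X →L[ℝ] Y} {α β δ : ℝ → ℝ} {x : ℝ → X} {y : ℝ → Y}

theorem IsSaddleFlow.ratio_absCont (H : IsSaddleFlow f g A α β δ x y) {ρ : ℝ → ℝ}
    (hρ : LocallyAbsCont ρ) : LocallyAbsCont (fun t => ρ t / β t) := by
  intro T hT
  have h := (H.absCont_β T hT).inv_of_pos fun t ht => H.β_pos t (by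
    rw [uIcc_of_le hT] at ht; exact ht.1)
  simpa only [div_eq_mul_inv] using! (hρ T hT).fun_mul h

theorem IsSaddleFlow.map_sub_absCont (H : IsSaddleFlow f g A α β δ x y) (u : X) :
    LocallyAbsCont (fun t => A (x t - u)) := fun T hT =>
  ((H.trajectory.locallyAbsCont_x T hT).fun_sub
    (absolutelyContinuousOnInterval_const u)).lipschitzOnWith_comp A.lipschitz.lipschitzOnWith
      (mapsTo_univ _ _)

theorem IsSaddleFlow.energy_absCont (H : IsSaddleFlow f g A α β δ x y) (u : X) (v : Y) :
    LocallyAbsCont (energy A α β δ x y u v) := by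
  intro T hT
  have hx := (H.trajectory.locallyAbsCont_x T hT).fun_sub (absolutelyContinuousOnInterval_const u)
  have hy := (H.trajectory.locallyAbsCont_y T hT).fun_sub (absolutelyContinuousOnInterval_const v)
  have h1 := (((H.ratio_absCont H.absCont_α) T hT).fun_mul
    (absolutelyContinuousOnInterval_const (2⁻¹ : ℝ))).fun_mul hx.norm_sq
  have h2 := (((H.ratio_absCont H.absCont_δ) T hT).fun_mul
    (absolutelyContinuousOnInterval_const (2⁻¹ : ℝ))).fun_mul hy.norm_sq
  exact (h1.fun_add h2).fun_add ((H.map_sub_absCont u T hT).inner hy)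

/-- The terms without velocities cancel after inserting X and Y. The two coupling terms, divided by
β, are minus the derivative of ⟨A(x - u), y - v⟩, while the product rule on the squared norms leaves
the derivatives of the ratios. -/
theorem IsSaddleFlow.gapRate_eq (H : IsSaddleFlow f g A α β δ x y) (u : X) (v : Y) :
    ∀ᵐ t ∂volume.restrict (Ioi (0 : ℝ)), gapRate A α β δ x y u v t =
      -deriv (energy A α β δ x y u v) t + deriv (fun t => α t / β t) t / 2 * ‖x t - u‖ ^ 2 +
        deriv (fun t => δ t / β t) t / 2 * ‖y t - v‖ ^ 2 := by
  filter_upwards [H.trajectory.inclusion, (H.ratio_absCont H.absCont_α).ae_differentiableAt,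
    (H.ratio_absCont H.absCont_δ).ae_differentiableAt, ae_restrict_mem measurableSet_Ioi]
    with t ⟨hx, hy, _, _⟩ hσ hτ ht
  have hβ := H.β_pos t (mem_Ioi.1 ht).le
  have hx' := hx.hasDerivAt.sub_const u
  have hy' := hy.hasDerivAt.sub_const v
  have hE := (((hσ.hasDerivAt.div_const 2).mul hx'.norm_sq).add
    ((hτ.hasDerivAt.div_const 2).mul hy'.norm_sq)).add
      ((A.hasFDerivAt.comp_hasDerivAt t hx').inner ℝ hy')
  have hE' := hE.deriv
  change deriv (energy A α β δ x y u v) t = _ at hE'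
  rw [hE', gapRate, primalSelection, dualSelection]
  simp only [inner_sub_left, inner_add_left, inner_neg_left, real_inner_smul_left,
    ContinuousLinearMap.adjoint_inner_left, Function.comp_apply, map_sub, inner_sub_right]
  rw [real_inner_comm (x t) (deriv x t), real_inner_comm u (deriv x t),
    real_inner_comm (A (x t)) (deriv y t), real_inner_comm (A u) (deriv y t),
    real_inner_comm (y t) (deriv y t), real_inner_comm v (deriv y t),
    real_inner_comm (A (x t)) (y t), real_inner_comm (A (x t)) v]
  field_simp
  ring

end Flow
end PrimalDual

/-! ### Integrated energy estimate and ergodic gap -/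

namespace PrimalDual

theorem GammaZero.aestronglyMeasurable_toReal_comp {E : Type*} [NormedAddCommGroup E]
    [InnerProductSpace ℝ E] {f : E → EReal} (hf : GammaZero f) {z : ℝ → E}
    (hz : ContinuousOn z (Ici 0)) (T : ℝ) :
    AEStronglyMeasurable (fun s => (f (z s)).toReal) (volume.restrict (Ioc 0 T)) := by
  -- Freezing z on the negative axis makes it continuous on ℝ, so that f composed with it is lower
  -- semicontinuous and Borel.
  have hc : Continuous fun s : ℝ => z (max s 0) := by
    rw [← continuousOn_univ]
    exact hz.comp (by fun_prop) fun s _ => le_max_right s 0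
  have hm : Measurable fun s : ℝ => (f (z (max s 0))).toReal :=
    measurable_ereal_toReal.comp (LowerSemicontinuous.comp hf.lsc hc).measurable
  refine hm.aestronglyMeasurable.congr ?_
  filter_upwards [ae_restrict_mem measurableSet_Ioc] with s hs
  rw [max_eq_left hs.1.le]

theorem ae_restrict_Ioc_of_Ioi {p : ℝ → Prop} (h : ∀ᵐ t ∂volume.restrict (Ioi (0 : ℝ)), p t)
    {S : ℝ} (hS : 0 ≤ S) (T : ℝ) : ∀ᵐ t ∂volume.restrict (Ioc S T), p t :=
  ae_restrict_of_ae_restrict_of_subset (fun _ hs => hS.trans_lt hs.1) h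

section Flow

variable {X Y : Type*} [NormedAddCommGroup X] [InnerProductSpace ℝ X] [CompleteSpace X]
  [NormedAddCommGroup Y] [InnerProductSpace ℝ Y] [CompleteSpace Y]
  {f : X → EReal} {g : Y → EReal} {A : X →L[ℝ] Y} {α β δ : ℝ → ℝ} {x : ℝ → X} {y : ℝ → Y}

theorem IsSaddleFlow.gapRate_le (H : IsSaddleFlow f g A α β δ x y) (u : X) (v : Y) :
    ∀ᵐ t ∂volume.restrict (Ioi (0 : ℝ)), gapRate A α β δ x y u v t ≤
      -deriv (energy A α β δ x y u v) t := by
  filter_upwards [H.gapRate_eq u v, ae_restrict_mem measurableSet_Ioi] with t ht ht0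
  rw [ht]
  have h1 := deriv_nonpos_of_antitoneOn_Ici H.antitone_α ht0
  have h2 := deriv_nonpos_of_antitoneOn_Ici H.antitone_δ ht0
  nlinarith [mul_nonpos_of_nonpos_of_nonneg h1 (sq_nonneg ‖x t - u‖),
    mul_nonpos_of_nonpos_of_nonneg h2 (sq_nonneg ‖y t - v‖)]

theorem IsSaddleFlow.continuousOn_x (H : IsSaddleFlow f g A α β δ x y) :
    ContinuousOn x (Ici 0) := H.trajectory.locallyAbsCont_x.continuousOn

theorem IsSaddleFlow.continuousOn_y (H : IsSaddleFlow f g A α β δ x y) :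
    ContinuousOn y (Ici 0) := H.trajectory.locallyAbsCont_y.continuousOn

theorem IsSaddleFlow.weight_pos (H : IsSaddleFlow f g A α β δ x y) {t : ℝ} (ht : 0 ≤ t) :
    0 < 1 / β t := one_div_pos.2 (H.β_pos t ht)

theorem IsSaddleFlow.continuousOn_weight (H : IsSaddleFlow f g A α β δ x y) :
    ContinuousOn (fun t => 1 / β t) (Ici 0) :=
  continuousOn_const.div H.absCont_β.continuousOn fun t ht => (H.β_pos t ht).ne'

theorem _root_.ContinuousOn.intervalIntegrable_of_Ici {V : Type*} [NormedAddCommGroup V]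
    {z : ℝ → V} (hz : ContinuousOn z (Ici 0)) {S T : ℝ} (hS : 0 ≤ S) (hT : S ≤ T) :
    IntervalIntegrable z volume S T :=
  (hz.mono fun _ hs => hS.trans hs.1).intervalIntegrable_of_Icc hT

/-- By `gapRate_eq` only derivatives of real absolutely continuous functions occur, multiplied by
continuous factors; integrability of the vector velocities is not needed. -/
theorem IsSaddleFlow.gapRate_intervalIntegrable (H : IsSaddleFlow f g A α β δ x y) (u : X) (v : Y)
    {S T : ℝ} (hS : 0 ≤ S) (hT : S ≤ T) :
    IntervalIntegrable (gapRate A α β δ x y u v) volume S T := by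
  have hx : ContinuousOn (fun t => ‖x t - u‖ ^ 2) (uIcc S T) :=
    ((H.continuousOn_x.sub continuousOn_const).norm.pow 2).mono fun t ht => by
      rw [uIcc_of_le hT] at ht
      exact hS.trans ht.1
  have hy : ContinuousOn (fun t => ‖y t - v‖ ^ 2) (uIcc S T) :=
    ((H.continuousOn_y.sub continuousOn_const).norm.pow 2).mono fun t ht => by
      rw [uIcc_of_le hT] at ht
      exact hS.trans ht.1
  have h1 := ((H.energy_absCont u v).intervalIntegrable_deriv hS hT).neg
  have h2 := (((H.ratio_absCont H.absCont_α).intervalIntegrable_deriv hS hT).div_const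
    2).mul_continuousOn hx
  have h3 := (((H.ratio_absCont H.absCont_δ).intervalIntegrable_deriv hS hT).div_const
    2).mul_continuousOn hy
  refine ((h1.add h2).add h3).congr_ae ?_
  rw [uIoc_of_le hT]
  filter_upwards [ae_restrict_Ioc_of_Ioi (H.gapRate_eq u v) hS T] with t ht
  rw [ht]
  rfl

theorem IsSaddleFlow.integral_gapRate_le (H : IsSaddleFlow f g A α β δ x y) (u : X) (v : Y)
    {S T : ℝ} (hS : 0 ≤ S) (hT : S ≤ T) :
    ∫ t in S..T, gapRate A α β δ x y u v t ≤
      energy A α β δ x y u v S - energy A α β δ x y u v T := by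
  have h := ((H.energy_absCont u v).mono hS hT).integral_deriv_eq_sub
  rw [← neg_sub, ← h, ← intervalIntegral.integral_neg]
  refine intervalIntegral.integral_mono_ae_restrict hT (H.gapRate_intervalIntegrable u v hS hT)
    ((H.energy_absCont u v).intervalIntegrable_deriv hS hT).neg ?_
  rw [Filter.EventuallyLE, ← restrict_Ioc_eq_restrict_Icc]
  exact ae_restrict_Ioc_of_Ioi (H.gapRate_le u v) hS T

/-- The quadratic part of the energy is uniformly coercive. -/
theorem IsSaddleFlow.exists_coercive (H : IsSaddleFlow f g A α β δ x y) :
    ∃ c : ℝ, 0 < c ∧ ∀ t, 0 ≤ t → ∀ (a : X) (b : Y), c * (‖a‖ ^ 2 + ‖b‖ ^ 2) ≤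
      (α t / β t) / 2 * ‖a‖ ^ 2 + (δ t / β t) / 2 * ‖b‖ ^ 2 + inner ℝ (A a) b := by
  obtain ⟨h1, h2⟩ := lt_min_iff.1 H.norm_lt
  have hle : ∀ ρ : ℝ → ℝ, ‖A‖ < ⨅ t : Ici (0 : ℝ), ρ t →
      ∀ t, 0 ≤ t → (⨅ t : Ici (0 : ℝ), ρ t) ≤ ρ t := by
    intro ρ hρ t ht
    have hb : BddBelow (range fun t : Ici (0 : ℝ) => ρ t) := by
      -- A real infimum that is unbounded below has the default value 0, which cannot exceed ‖A‖.
      by_contra hcon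
      rw [Real.iInf_of_not_bddBelow hcon] at hρ
      exact absurd hρ (not_lt.2 (norm_nonneg A))
    exact ciInf_le hb ⟨t, ht⟩
  set m := min (⨅ t : Ici (0 : ℝ), α t / β t) (⨅ t : Ici (0 : ℝ), δ t / β t) with hm
  have hmA : ‖A‖ < m := H.norm_lt
  -- The constant comes from ‖A‖‖a‖‖b‖ ≤ ‖A‖(‖a‖² + ‖b‖²)/2.
  refine ⟨(m - ‖A‖) / 2, by linarith, fun t ht a b => ?_⟩
  have h3 : m ≤ α t / β t := (min_le_left _ _).trans (hle (fun t => α t / β t) h1 t ht)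
  have h4 : m ≤ δ t / β t := (min_le_right _ _).trans (hle (fun t => δ t / β t) h2 t ht)
  have h5 : -(‖A‖ * ‖a‖ * ‖b‖) ≤ inner ℝ (A a) b := by
    refine (neg_le_neg ?_).trans (neg_le_of_abs_le (abs_real_inner_le_norm (A a) b))
    exact mul_le_mul_of_nonneg_right (A.le_opNorm a) (norm_nonneg b)
  have h6 := mul_le_mul_of_nonneg_right h3 (sq_nonneg ‖a‖)
  have h7 := mul_le_mul_of_nonneg_right h4 (sq_nonneg ‖b‖)
  nlinarith [mul_nonneg (norm_nonneg A) (sq_nonneg (‖a‖ - ‖b‖))]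

theorem IsSaddleFlow.energy_nonneg (H : IsSaddleFlow f g A α β δ x y) (u : X) (v : Y) {t : ℝ}
    (ht : 0 ≤ t) : 0 ≤ energy A α β δ x y u v t := by
  obtain ⟨c, hc, h⟩ := H.exists_coercive
  exact le_trans (by positivity) (h t ht (x t - u) (y t - v))

/-- The inclusions hold at some time, since the half-line has positive measure. The subgradients
found there supply affine minorants of f and g*, and a point where g* is finite. -/
theorem IsSaddleFlow.exists_subgradients (H : IsSaddleFlow f g A α β δ x y) :
    ∃ (u p : X) (v q : Y), p ∈ subdifferential f u ∧ q ∈ subdifferential (conjugate g) v := by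
  have : NeZero (volume.restrict (Ioi (0 : ℝ))) := ⟨by simp [Measure.restrict_eq_zero]⟩
  obtain ⟨t, -, -, h1, h2⟩ := H.trajectory.inclusion.exists
  exact ⟨_, _, _, _, h1, h2⟩

theorem IsSaddleFlow.gammaZero_conjugate (H : IsSaddleFlow f g A α β δ x y) :
    GammaZero (conjugate g) := by
  obtain ⟨u, p, v, q, -, h⟩ := H.exists_subgradients
  exact PrimalDual.gammaZero_conjugate H.gammaZero_dual h.2.1

theorem IsSaddleFlow.ae_ne_top (H : IsSaddleFlow f g A α β δ x y) :
    ∀ᵐ t ∂volume.restrict (Ioi (0 : ℝ)), f (x t) ≠ ⊤ ∧ conjugate g (y t) ≠ ⊤ := by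
  filter_upwards [H.trajectory.inclusion] with t ht
  exact ⟨ht.2.2.1.2.1, ht.2.2.2.2.1⟩

theorem IsSaddleFlow.weighted_gap_le_gapRate (H : IsSaddleFlow f g A α β δ x y) {u : X} {v : Y}
    (hu : f u ≠ ⊤) (hv : conjugate g v ≠ ⊤) :
    ∀ᵐ t ∂volume.restrict (Ioi (0 : ℝ)),
      1 / β t * ((f (x t)).toReal + (conjugate g (y t)).toReal - (f u).toReal -
        (conjugate g v).toReal + inner ℝ v (A (x t)) - inner ℝ (y t) (A u)) ≤
      gapRate A α β δ x y u v t := by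
  filter_upwards [H.trajectory.inclusion, ae_restrict_mem measurableSet_Ioi] with t ht ht0
  have h1 := toReal_add_inner_le_of_mem_subdifferential ht.2.2.1 hu
  have h2 := toReal_add_inner_le_of_mem_subdifferential ht.2.2.2 hv
  rw [← neg_sub, inner_neg_right] at h1 h2
  refine mul_le_mul_of_nonneg_left ?_ (H.weight_pos (mem_Ioi.1 ht0).le).le
  linarith

/-- Affine minorants bound each term from below. `weighted_gap_le_gapRate` bounds only the sum from
above, and subtracting the minorant of one term bounds the other. -/
theorem IsSaddleFlow.intervalIntegrable_weighted_values (H : IsSaddleFlow f g A α β δ x y)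
    {S T : ℝ} (hS : 0 ≤ S) (hT : S ≤ T) :
    IntervalIntegrable (fun t => 1 / β t * (f (x t)).toReal) volume S T ∧
      IntervalIntegrable (fun t => 1 / β t * (conjugate g (y t)).toReal) volume S T := by
  obtain ⟨u, p, v, q, hp, hq⟩ := H.exists_subgradients
  have hx := H.continuousOn_x
  have hy := H.continuousOn_y
  have hw := H.continuousOn_weight
  have ha : ContinuousOn (fun t => 1 / β t * ((f u).toReal + inner ℝ p (x t - u))) (Ici 0) := by
    fun_prop
  have hb : ContinuousOn (fun t => 1 / β t * ((conjugate g v).toReal + inner ℝ q (y t - v)))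
      (Ici 0) := by fun_prop
  have hc : ContinuousOn (fun t => 1 / β t * ((f u).toReal +
        (conjugate g v).toReal - inner ℝ v (A (x t)) + inner ℝ (y t) (A u))) (Ici 0) := by
    fun_prop
  have hsum := (H.gapRate_intervalIntegrable u v hS hT).add (hc.intervalIntegrable_of_Ici hS hT)
  have hmw : AEStronglyMeasurable (fun t => 1 / β t) (volume.restrict (Ioc S T)) :=
    (hw.intervalIntegrable_of_Ici hS hT).1.aestronglyMeasurable
  have hsub : Ioc S T ⊆ Ioc 0 T := Ioc_subset_Ioc_left hS
  have hmf := hmw.mul ((H.gammaZero_primal.aestronglyMeasurable_toReal_comp hx T).mono_set hsub)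
  have hmg := hmw.mul ((H.gammaZero_conjugate.aestronglyMeasurable_toReal_comp hy T).mono_set hsub)
  have hlow : ∀ᵐ t ∂volume.restrict (Ioi (0 : ℝ)),
      1 / β t * ((f u).toReal + inner ℝ p (x t - u)) ≤ 1 / β t * (f (x t)).toReal ∧
      1 / β t * ((conjugate g v).toReal + inner ℝ q (y t - v)) ≤
        1 / β t * (conjugate g (y t)).toReal := by
    filter_upwards [H.ae_ne_top, ae_restrict_mem measurableSet_Ioi] with t ht ht0
    have hw0 := (H.weight_pos (mem_Ioi.1 ht0).le).le
    exact ⟨mul_le_mul_of_nonneg_left (toReal_add_inner_le_of_mem_subdifferential hp ht.1) hw0,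
      mul_le_mul_of_nonneg_left (toReal_add_inner_le_of_mem_subdifferential hq ht.2) hw0⟩
  have hlow' := ae_restrict_Ioc_of_Ioi hlow hS T
  have hup := ae_restrict_Ioc_of_Ioi (H.weighted_gap_le_gapRate hp.2.1 hq.2.1) hS T
  simp only [intervalIntegrable_iff_integrableOn_Ioc_of_le hT] at hsum ⊢
  have hai := (intervalIntegrable_iff_integrableOn_Ioc_of_le hT).1
    (ha.intervalIntegrable_of_Ici hS hT)
  have hbi := (intervalIntegrable_iff_integrableOn_Ioc_of_le hT).1
    (hb.intervalIntegrable_of_Ici hS hT)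
  constructor
  · refine integrable_of_le_of_le hmf (hlow'.mono fun t ht => ht.1) ?_ hai (hsum.sub hbi)
    filter_upwards [hlow', hup] with t ht ht'
    simp only [Pi.sub_apply, mul_add, mul_sub] at ht ht' ⊢
    linarith [ht.2]
  · refine integrable_of_le_of_le hmg (hlow'.mono fun t ht => ht.2) ?_ hbi (hsum.sub hai)
    filter_upwards [hlow', hup] with t ht ht'
    simp only [Pi.sub_apply, mul_add, mul_sub] at ht ht' ⊢
    linarith [ht.1]

theorem IsSaddleFlow.mass_pos (H : IsSaddleFlow f g A α β δ x y) {t : ℝ} (ht : 0 < t) :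
    0 < ∫ s in (0 : ℝ)..t, 1 / β s :=
  intervalIntegral.intervalIntegral_pos_of_pos_on
    (H.continuousOn_weight.intervalIntegrable_of_Ici le_rfl ht.le)
    (fun _ hs => H.weight_pos hs.1.le) ht

/-- Ergodic averages commute with continuous linear functionals. -/
theorem map_ergodic {V : Type*} [NormedAddCommGroup V] [InnerProductSpace ℝ V] [CompleteSpace V]
    {z : ℝ → V} {t : ℝ} (hz : IntervalIntegrable (fun s => (1 / β s) • z s) volume 0 t)
    (ℓ : V →L[ℝ] ℝ) : ℓ (ergodic β z t) =
      (∫ s in (0 : ℝ)..t, 1 / β s)⁻¹ * ∫ s in (0 : ℝ)..t, 1 / β s * ℓ (z s) := by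
  rw [ergodic, map_smul, ← ContinuousLinearMap.intervalIntegral_comp_comm _ hz]
  simp only [map_smul, smul_eq_mul]

/-- The gap is convex in (x, y): Jensen handles f and g*, the remaining terms commute with
averaging, and E(t) ≥ 0 is dropped. -/
theorem IsSaddleFlow.ergodic_gap (H : IsSaddleFlow f g A α β δ x y) {t : ℝ} (ht : 0 < t) :
    f (ergodic β x t) ≠ ⊤ ∧ conjugate g (ergodic β y t) ≠ ⊤ ∧
    ∀ (u : X) (v : Y), f u ≠ ⊤ → conjugate g v ≠ ⊤ →
      (f (ergodic β x t)).toReal + (conjugate g (ergodic β y t)).toReal - (f u).toReal -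
        (conjugate g v).toReal + inner ℝ v (A (ergodic β x t)) - inner ℝ (ergodic β y t) (A u) ≤
      (∫ s in (0 : ℝ)..t, 1 / β s)⁻¹ * energy A α β δ x y u v 0 := by
  have hw := H.continuousOn_weight
  have hwi := hw.intervalIntegrable_of_Ici le_rfl ht.le
  have hw0 : ∀ s, 0 ≤ s → 0 ≤ 1 / β s := fun s hs => (H.weight_pos hs).le
  have hW := H.mass_pos ht
  have hxi := (hw.smul H.continuousOn_x).intervalIntegrable_of_Ici le_rfl ht.le
  have hyi := (hw.smul H.continuousOn_y).intervalIntegrable_of_Ici le_rfl ht.le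
  obtain ⟨hF, hG⟩ := H.intervalIntegrable_weighted_values le_rfl ht.le
  have hfin := ae_restrict_Ioc_of_Ioi H.ae_ne_top le_rfl t
  have hJf := H.gammaZero_primal.ergodic_le ht.le hwi hw0 hW hxi hF
    (hfin.mono fun s hs => EReal.le_coe_toReal hs.1)
  have hJg := H.gammaZero_conjugate.ergodic_le ht.le hwi hw0 hW hyi hG
    (hfin.mono fun s hs => EReal.le_coe_toReal hs.2)
  have hf : f (ergodic β x t) ≠ ⊤ := ne_top_of_le_ne_top (EReal.coe_ne_top _) hJf
  have hg : conjugate g (ergodic β y t) ≠ ⊤ := ne_top_of_le_ne_top (EReal.coe_ne_top _) hJg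
  refine ⟨hf, hg, fun u v hu hv => ?_⟩
  rw [← H.gammaZero_primal.coe_toReal hf, EReal.coe_le_coe_iff] at hJf
  rw [← H.gammaZero_conjugate.coe_toReal hg, EReal.coe_le_coe_iff] at hJg
  have hix := map_ergodic hxi ((innerSL ℝ v).comp A)
  have hiy := map_ergodic hyi (innerSL ℝ (A u))
  simp only [ContinuousLinearMap.comp_apply, innerSL_apply_apply] at hix hiy
  have hx := H.continuousOn_x
  have hy := H.continuousOn_y
  have hc1 : ContinuousOn (fun s => 1 / β s * inner ℝ v (A (x s))) (Ici 0) := by fun_prop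
  have hc2 : ContinuousOn (fun s => 1 / β s * inner ℝ (A u) (y s)) (Ici 0) := by fun_prop
  have hi1 := hc1.intervalIntegrable_of_Ici le_rfl ht.le
  have hi2 := hc2.intervalIntegrable_of_Ici le_rfl ht.le
  have hi3 := hwi.mul_const ((f u).toReal + (conjugate g v).toReal)
  have hint := (((hF.add hG).sub hi3).add hi1).sub hi2
  have hle := intervalIntegral.integral_mono_ae_restrict ht.le hint
    (H.gapRate_intervalIntegrable u v le_rfl ht.le) (by
      rw [Filter.EventuallyLE, ← restrict_Ioc_eq_restrict_Icc]
      filter_upwards [ae_restrict_Ioc_of_Ioi (H.weighted_gap_le_gapRate hu hv) le_rfl t] with s hs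
      refine le_trans (le_of_eq ?_) hs
      rw [real_inner_comm (y s) (A u)]
      ring)
  have hE := H.integral_gapRate_le u v le_rfl ht.le
  have hEt := H.energy_nonneg u v ht.le
  have hsplit := calc
    _ = _ := intervalIntegral.integral_sub (((hF.add hG).sub hi3).add hi1) hi2
    _ = _ := by rw [intervalIntegral.integral_add ((hF.add hG).sub hi3) hi1,
                  intervalIntegral.integral_sub (hF.add hG) hi3,
                  intervalIntegral.integral_add hF hG, intervalIntegral.integral_mul_const]
  rw [hsplit] at hle
  have hfinal := mul_le_mul_of_nonneg_left (hle.trans (hE.trans (sub_le_self _ hEt)))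
    (inv_nonneg.2 hW.le)
  refine le_trans ?_ hfinal
  rw [hix, real_inner_comm, hiy]
  have hcancel : (∫ s in (0 : ℝ)..t, 1 / β s)⁻¹ * ((∫ s in (0 : ℝ)..t, 1 / β s) *
      ((f u).toReal + (conjugate g v).toReal)) = (f u).toReal + (conjugate g v).toReal := by
    rw [inv_mul_cancel_left₀ hW.ne']
  simp only [mul_add, mul_sub] at hcancel ⊢
  linarith

end Flow
end PrimalDual

/-! ### Weak limit points of pairs -/

namespace PrimalDual

section Pairs

variable {X Y : Type*} [NormedAddCommGroup X] [InnerProductSpace ℝ X] [CompleteSpace X]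
  [NormedAddCommGroup Y] [InnerProductSpace ℝ Y] [CompleteSpace Y]

theorem exists_weakLimit_subseq {a : ℕ → X} {b : ℕ → Y} {C : ℝ}
    (h : ∀ᶠ n in atTop, ‖a n‖ ≤ C ∧ ‖b n‖ ≤ C) :
    ∃ (p : X × Y) (σ : ℕ → ℕ), Tendsto σ atTop atTop ∧
      TendstoWeakly (fun k => a (σ k)) atTop p.1 ∧ TendstoWeakly (fun k => b (σ k)) atTop p.2 := by
  obtain ⟨N, hN⟩ := eventually_atTop.1 h
  -- The shift by N makes the eventual bound hold for every index; the second extraction refines the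
  -- first.
  obtain ⟨p, σ, hσ, hp⟩ := exists_subseq_tendstoWeakly (z := fun n => a (n + N))
    fun n => (hN _ (Nat.le_add_left N n)).1
  obtain ⟨q, θ, hθ, hq⟩ := exists_subseq_tendstoWeakly (z := fun n => b (σ n + N))
    fun n => (hN _ (Nat.le_add_left N _)).2
  refine ⟨(p, q), fun k => σ (θ k) + N, ?_, hp.comp hθ.tendsto_atTop, hq⟩
  exact (tendsto_add_atTop_nat N).comp (hσ.tendsto_atTop.comp hθ.tendsto_atTop)

theorem weakLimitPoints_nonempty {z : ℝ → X} {w : ℝ → Y} {C : ℝ}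
    (h : ∀ t, 0 < t → ‖z t‖ ≤ C ∧ ‖w t‖ ≤ C) : (weakLimitPoints z w).Nonempty := by
  obtain ⟨p, σ, hσ, hp, hq⟩ := exists_weakLimit_subseq (a := fun n : ℕ => z n)
    (b := fun n : ℕ => w n) ((eventually_gt_atTop 0).mono fun n hn => h n (Nat.cast_pos.2 hn))
  exact ⟨p, fun k => (σ k : ℝ), tendsto_natCast_atTop_atTop.comp hσ, hp, hq⟩

/-- A bounded trajectory with at most one weak subsequential limit point converges weakly. -/
theorem tendstoWeakly_of_weakLimitPoints_subset {z : ℝ → X} {w : ℝ → Y} {C : ℝ}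
    (h : ∀ t, 0 < t → ‖z t‖ ≤ C ∧ ‖w t‖ ≤ C) {p : X × Y} (hp : weakLimitPoints z w ⊆ {p}) :
    TendstoWeakly z atTop p.1 ∧ TendstoWeakly w atTop p.2 := by
  have key : ∀ τ : ℕ → ℝ, Tendsto τ atTop atTop → ∃ σ : ℕ → ℕ,
      TendstoWeakly (fun k => z (τ (σ k))) atTop p.1 ∧
        TendstoWeakly (fun k => w (τ (σ k))) atTop p.2 := by
    intro τ hτ
    obtain ⟨q, σ, hσ, h1, h2⟩ := exists_weakLimit_subseq (a := fun n => z (τ n))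
      (b := fun n => w (τ n)) ((hτ.eventually_gt_atTop 0).mono fun n hn => h _ hn)
    have hq : q = p := hp ⟨fun k => τ (σ k), hτ.comp hσ, h1, h2⟩
    exact ⟨σ, hq ▸ h1, hq ▸ h2⟩
  constructor
  · exact tendsto_of_subseq_tendsto fun τ hτ => (key τ hτ).imp fun σ h => h.1
  · exact tendsto_of_subseq_tendsto fun τ hτ => (key τ hτ).imp fun σ h => h.2

end Pairs

/-! ### Boundedness, Bregman estimate and weak limits -/

section Flow

variable {X Y : Type*} [NormedAddCommGroup X] [InnerProductSpace ℝ X] [CompleteSpace X]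
  [NormedAddCommGroup Y] [InnerProductSpace ℝ Y] [CompleteSpace Y]
  {f : X → EReal} {g : Y → EReal} {A : X →L[ℝ] Y} {α β δ : ℝ → ℝ} {x : ℝ → X} {y : ℝ → Y}

theorem IsSaddleFlow.lagrangian_gap_le (H : IsSaddleFlow f g A α β δ x y) (u : X) (v : Y)
    {t : ℝ} (ht : 0 < t) :
    lagrangian f g A (ergodic β x t) v - lagrangian f g A u (ergodic β y t) ≤
      (((∫ s in (0 : ℝ)..t, 1 / β s)⁻¹ * energy A α β δ x y u v 0 : ℝ) : EReal) := by
  obtain ⟨hx, hy, hgap⟩ := H.ergodic_gap ht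
  have hG := H.gammaZero_conjugate
  have hF := H.gammaZero_primal
  -- In both infinite cases the extended-real difference is ⊥: either its first term is ⊥, or ⊤ is
  -- subtracted.
  by_cases hv : conjugate g v = ⊤
  · simp [lagrangian, hv]
  by_cases hu : f u = ⊤
  · have : lagrangian f g A u (ergodic β y t) = ⊤ := by
      rw [lagrangian, hu, EReal.top_add_coe, ← hG.coe_toReal hy, EReal.top_sub_coe]
    simp [this]
  have h := hgap u v hu hv
  simp only [lagrangian]
  rw [← hF.coe_toReal hx, ← hF.coe_toReal hu, ← hG.coe_toReal hy, ← hG.coe_toReal hv]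
  norm_cast
  linarith

/-- Subgradients along the trajectory give d ≥ 0; those at the solution make the Lagrangian gap
nonnegative, whence d/β ≤ `gapRate`. The last identity serves to prove integrability. -/
theorem IsSaddleFlow.bregman_eq (H : IsSaddleFlow f g A α β δ x y) {p : X × Y}
    (hp : p ∈ solutions f g A) : ∀ᵐ t ∂volume.restrict (Ioi (0 : ℝ)), ∃ r : ℝ,
      bregman f g A α β β δ x y p.1 p.2 t = (r : EReal) ∧ 0 ≤ r ∧
      r / β t ≤ gapRate A α β δ x y p.1 p.2 t ∧
      r / β t = gapRate A α β δ x y p.1 p.2 t - (1 / β t * (f (x t)).toReal +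
        1 / β t * (conjugate g (y t)).toReal) + 1 / β t * ((f p.1).toReal +
          (conjugate g p.2).toReal - inner ℝ p.2 (A (x t)) + inner ℝ (y t) (A p.1)) := by
  obtain ⟨hp1, hp2⟩ := hp
  have hG := H.gammaZero_conjugate
  have hF := H.gammaZero_primal
  filter_upwards [H.trajectory.inclusion, H.ae_ne_top, ae_restrict_mem measurableSet_Ioi]
    with t ht hfin ht0
  have hw := H.weight_pos (mem_Ioi.1 ht0).le
  have h1 := toReal_add_inner_le_of_mem_subdifferential ht.2.2.1 hp1.2.1
  have h2 := toReal_add_inner_le_of_mem_subdifferential ht.2.2.2 hp2.2.1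
  have h3 := toReal_add_inner_le_of_mem_subdifferential hp1 hfin.1
  have h4 := toReal_add_inner_le_of_mem_subdifferential hp2 hfin.2
  refine ⟨((f p.1).toReal - (f (x t)).toReal -
      inner ℝ (primalSelection A α β x y t) (p.1 - x t)) +
    ((conjugate g p.2).toReal - (conjugate g (y t)).toReal -
      inner ℝ (dualSelection A β δ x y t) (p.2 - y t)), ?_, ?_, ?_, ?_⟩
  · rw [bregman, ← hF.coe_toReal hfin.1, ← hF.coe_toReal hp1.2.1, ← hG.coe_toReal hfin.2,
      ← hG.coe_toReal hp2.2.1]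
    norm_cast
  · linarith
  · rw [gapRate, div_eq_inv_mul, ← one_div]
    refine mul_le_mul_of_nonneg_left ?_ hw.le
    rw [inner_neg_left, ContinuousLinearMap.adjoint_inner_left, map_sub, inner_sub_right] at h3
    rw [inner_sub_right, real_inner_comm (y t), real_inner_comm p.2] at h4
    simp only [inner_sub_right] at h1 h2 h3 h4 ⊢
    linarith
  · rw [gapRate]
    simp only [inner_sub_right]
    ring

theorem IsSaddleFlow.bregman_toReal_intervalIntegrable (H : IsSaddleFlow f g A α β δ x y)
    {p : X × Y} (hp : p ∈ solutions f g A) {T : ℝ} (hT : 0 ≤ T) :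
    IntervalIntegrable (fun s => (bregman f g A α β β δ x y p.1 p.2 s).toReal / β s) volume 0 T := by
  have hx := H.continuousOn_x
  have hy := H.continuousOn_y
  have hw := H.continuousOn_weight
  have hc : ContinuousOn (fun t => 1 / β t * ((f p.1).toReal + (conjugate g p.2).toReal -
      inner ℝ p.2 (A (x t)) + inner ℝ (y t) (A p.1))) (Ici 0) := by fun_prop
  obtain ⟨h1, h2⟩ := H.intervalIntegrable_weighted_values le_rfl hT
  refine (((H.gapRate_intervalIntegrable p.1 p.2 le_rfl hT).sub (h1.add h2)).add
    (hc.intervalIntegrable_of_Ici le_rfl hT)).congr_ae ?_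
  rw [uIoc_of_le hT]
  filter_upwards [ae_restrict_Ioc_of_Ioi (H.bregman_eq hp) le_rfl T] with t ⟨r, hr, _, _, heq⟩
  rw [hr, EReal.toReal_coe, heq]

theorem IsSaddleFlow.integral_bregman_le (H : IsSaddleFlow f g A α β δ x y)
    {p : X × Y} (hp : p ∈ solutions f g A) {T : ℝ} (hT : 0 ≤ T) :
    ∫ s in (0 : ℝ)..T, (bregman f g A α β β δ x y p.1 p.2 s).toReal / β s ≤
      energy A α β δ x y p.1 p.2 0 := by
  refine le_trans ?_ ((H.integral_gapRate_le p.1 p.2 le_rfl hT).trans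
    (sub_le_self _ (H.energy_nonneg p.1 p.2 hT)))
  refine intervalIntegral.integral_mono_ae_restrict hT (H.bregman_toReal_intervalIntegrable hp hT)
    (H.gapRate_intervalIntegrable p.1 p.2 le_rfl hT) ?_
  rw [Filter.EventuallyLE, ← restrict_Ioc_eq_restrict_Icc]
  filter_upwards [ae_restrict_Ioc_of_Ioi (H.bregman_eq hp) le_rfl T] with t ⟨r, hr, _, hle, _⟩
  rwa [hr, EReal.toReal_coe]

theorem IsSaddleFlow.bregman_integrableOn (H : IsSaddleFlow f g A α β δ x y)
    {p : X × Y} (hp : p ∈ solutions f g A) :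
    IntegrableOn (fun s => (bregman f g A α β β δ x y p.1 p.2 s).toReal / β s) (Ioi 0) := by
  refine integrableOn_Ioi_of_intervalIntegral_norm_bounded (l := atTop)
    (b := fun n : ℕ => (n : ℝ)) (energy A α β δ x y p.1 p.2 0) 0 (fun n => ?_)
    tendsto_natCast_atTop_atTop (Eventually.of_forall fun n => ?_)
  · exact (intervalIntegrable_iff_integrableOn_Ioc_of_le n.cast_nonneg).1
      (H.bregman_toReal_intervalIntegrable hp n.cast_nonneg)
  · refine le_trans (le_of_eq ?_) (H.integral_bregman_le hp n.cast_nonneg)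
    refine intervalIntegral.integral_congr_ae_restrict ?_
    rw [uIoc_of_le n.cast_nonneg]
    filter_upwards [ae_restrict_Ioc_of_Ioi (H.bregman_eq hp) le_rfl n,
      ae_restrict_mem measurableSet_Ioc] with t ⟨r, hr, hr0, _, _⟩ ht
    rw [hr, EReal.toReal_coe, Real.norm_of_nonneg (div_nonneg hr0 (H.β_pos t ht.1.le).le)]

theorem IsSaddleFlow.energy_antitoneOn (H : IsSaddleFlow f g A α β δ x y)
    {p : X × Y} (hp : p ∈ solutions f g A) :
    AntitoneOn (energy A α β δ x y p.1 p.2) (Ici 0) := by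
  intro S hS T _ hST
  rw [← sub_nonneg]
  refine le_trans ?_ (H.integral_gapRate_le p.1 p.2 hS hST)
  refine intervalIntegral.integral_nonneg_of_ae_restrict hST ?_
  rw [Filter.EventuallyLE, ← restrict_Ioc_eq_restrict_Icc]
  filter_upwards [ae_restrict_Ioc_of_Ioi (H.bregman_eq hp) hS T,
    ae_restrict_mem measurableSet_Ioc] with t ⟨r, _, hr0, hle, _⟩ ht
  exact (div_nonneg hr0 (H.β_pos t ((mem_Ici.1 hS).trans ht.1.le)).le).trans hle

theorem IsSaddleFlow.exists_bound (H : IsSaddleFlow f g A α β δ x y)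
    (hS : (solutions f g A).Nonempty) : ∃ C : ℝ, ∀ t, 0 ≤ t → ‖x t‖ ≤ C ∧ ‖y t‖ ≤ C := by
  obtain ⟨p, hp⟩ := hS
  obtain ⟨c, hc, hcoe⟩ := H.exists_coercive
  set M := energy A α β δ x y p.1 p.2 0 / c
  refine ⟨√M + ‖p.1‖ + ‖p.2‖, fun t ht => ?_⟩
  have h1 : ‖x t - p.1‖ ^ 2 + ‖y t - p.2‖ ^ 2 ≤ M := by
    rw [le_div_iff₀' hc]
    exact (hcoe t ht (x t - p.1) (y t - p.2)).trans
      (H.energy_antitoneOn hp self_mem_Ici ht ht)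
  have h2 : ‖x t - p.1‖ ≤ √M := Real.le_sqrt_of_sq_le (by nlinarith [sq_nonneg ‖y t - p.2‖])
  have h3 : ‖y t - p.2‖ ≤ √M := Real.le_sqrt_of_sq_le (by nlinarith [sq_nonneg ‖x t - p.1‖])
  have h4 := norm_le_norm_sub_add (x t) p.1
  have h5 := norm_le_norm_sub_add (y t) p.2
  have h6 := norm_nonneg p.1
  have h7 := norm_nonneg p.2
  constructor <;> linarith

theorem IsSaddleFlow.norm_ergodic_le (H : IsSaddleFlow f g A α β δ x y) {V : Type*}
    [NormedAddCommGroup V] [InnerProductSpace ℝ V] [CompleteSpace V] {z : ℝ → V}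
    (hz : ContinuousOn z (Ici 0)) {C : ℝ} (hC : ∀ t, 0 ≤ t → ‖z t‖ ≤ C) {t : ℝ} (ht : 0 < t) :
    ‖ergodic β z t‖ ≤ C := by
  have hw := H.continuousOn_weight
  have h := (convex_closedBall (0 : V) C).weighted_average_mem Metric.isClosed_closedBall ht.le
    (hw.intervalIntegrable_of_Ici le_rfl ht.le)
    ((ae_restrict_mem measurableSet_Ioc).mono fun s hs => (H.weight_pos hs.1.le).le)
    (H.mass_pos ht) ((hw.smul hz).intervalIntegrable_of_Ici le_rfl ht.le)
    ((ae_restrict_mem measurableSet_Ioc).mono fun s hs => by simpa using hC s hs.1.le)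
  simpa [ergodic] using h

theorem IsSaddleFlow.exists_ergodic_bound (H : IsSaddleFlow f g A α β δ x y)
    (hS : (solutions f g A).Nonempty) :
    ∃ C : ℝ, ∀ t, 0 < t → ‖ergodic β x t‖ ≤ C ∧ ‖ergodic β y t‖ ≤ C := by
  obtain ⟨C, hC⟩ := H.exists_bound hS
  exact ⟨C, fun t ht => ⟨H.norm_ergodic_le H.continuousOn_x (fun s hs => (hC s hs).1) ht,
    H.norm_ergodic_le H.continuousOn_y (fun s hs => (hC s hs).2) ht⟩⟩

theorem IsSaddleFlow.mass_tendsto (H : IsSaddleFlow f g A α β δ x y)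
    (hint : ¬ IntegrableOn (fun s => 1 / β s) (Ioi 0)) :
    Tendsto (fun t => ∫ s in (0 : ℝ)..t, 1 / β s) atTop atTop := by
  have hi : ∀ {S T : ℝ}, 0 ≤ S → S ≤ T → IntervalIntegrable (fun s => 1 / β s) volume S T :=
    fun hS hT => H.continuousOn_weight.intervalIntegrable_of_Ici hS hT
  have hmono : ∀ S T : ℝ, 0 ≤ S → S ≤ T →
      ∫ s in (0 : ℝ)..S, 1 / β s ≤ ∫ s in (0 : ℝ)..T, 1 / β s := by
    intro S T hS hT
    rw [← intervalIntegral.integral_add_adjacent_intervals (hi le_rfl hS) (hi hS hT)]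
    exact le_add_of_nonneg_right (intervalIntegral.integral_nonneg hT fun s hs =>
      (H.weight_pos (hS.trans hs.1)).le)
  rw [tendsto_atTop]
  intro I
  by_contra hcon
  refine hint (integrableOn_Ioi_of_intervalIntegral_norm_bounded (l := atTop)
    (b := fun n : ℕ => (n : ℝ)) I 0 (fun n => ?_) tendsto_natCast_atTop_atTop
    (Eventually.of_forall fun n => ?_))
  · exact (intervalIntegrable_iff_integrableOn_Ioc_of_le n.cast_nonneg).1 (hi le_rfl n.cast_nonneg)
  · have h1 : ∫ s in (0 : ℝ)..n, ‖1 / β s‖ = ∫ s in (0 : ℝ)..n, 1 / β s := by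
      refine intervalIntegral.integral_congr fun s hs => ?_
      rw [uIcc_of_le n.cast_nonneg] at hs
      exact Real.norm_of_nonneg (H.weight_pos hs.1).le
    rw [h1]
    -- If the mass exceeded I at some integer, monotonicity would keep it above I from then on.
    by_contra hn
    refine hcon ((eventually_ge_atTop (n : ℝ)).mono fun t ht => ?_)
    exact (not_le.1 hn).le.trans (hmono n t n.cast_nonneg ht)

theorem IsSaddleFlow.weakLimitPoints_subset (H : IsSaddleFlow f g A α β δ x y)
    (hint : ¬ IntegrableOn (fun s => 1 / β s) (Ioi 0)) :
    weakLimitPoints (ergodic β x) (ergodic β y) ⊆ solutions f g A := by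
  rintro ⟨p, q⟩ ⟨τ, hτ, hp, hq⟩
  simp only at hp hq
  have hG := H.gammaZero_conjugate
  have hF := H.gammaZero_primal
  have key : ∀ u v, f u ≠ ⊤ → conjugate g v ≠ ⊤ → f p + conjugate g q ≤
      (((f u).toReal + (conjugate g v).toReal - inner ℝ v (A p) + inner ℝ (A u) q : ℝ) :
        EReal) := by
    intro u v hu hv
    -- Weak lower semicontinuity enters through real numbers r < f p and s < g* q, which persist
    -- along the averages while the bound on the gap tends to 0.
    refine EReal.add_le_of_forall_lt fun r hr s hs => ?_
    induction r with
    | bot => simp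
    | top => exact absurd hr not_top_lt
    | coe r =>
    induction s with
    | bot => simp
    | top => exact absurd hs not_top_lt
    | coe s =>
    rw [← EReal.coe_add, EReal.coe_le_coe_iff]
    have hlhs := (((hp.inner_tendsto (A.adjoint v)).const_add
      (r + s - (f u).toReal - (conjugate g v).toReal))).sub (hq.inner_tendsto (A u))
    have hrhs : Tendsto (fun k => (∫ s in (0 : ℝ)..τ k, 1 / β s)⁻¹ * energy A α β δ x y u v 0)
        atTop (𝓝 (0 * energy A α β δ x y u v 0)) :=
      (((H.mass_tendsto hint).comp hτ).inv_tendsto_atTop).mul_const _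
    have hle := le_of_tendsto_of_tendsto hlhs hrhs (by
      filter_upwards [hF.eventually_lt_of_tendstoWeakly hp hr,
        hG.eventually_lt_of_tendstoWeakly hq hs, hτ.eventually_gt_atTop 0] with k h1 h2 h3
      obtain ⟨hx, hy, hgap⟩ := H.ergodic_gap h3
      rw [← hF.coe_toReal hx, EReal.coe_lt_coe_iff] at h1
      rw [← hG.coe_toReal hy, EReal.coe_lt_coe_iff] at h2
      have h4 := hgap u v hu hv
      rw [real_inner_comm] at h4
      rw [ContinuousLinearMap.adjoint_inner_left]
      rw [real_inner_comm] at h4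
      rw [real_inner_comm (ergodic β y (τ k))]
      linarith)
    rw [ContinuousLinearMap.adjoint_inner_left] at hle
    linarith
  obtain ⟨u₀, hu₀⟩ := hF.exists_ne_top
  obtain ⟨v₀, hv₀⟩ := hG.exists_ne_top
  have h0 := key u₀ v₀ hu₀ hv₀
  have hfp : f p ≠ ⊤ := by
    intro h
    rw [h, EReal.top_add_of_ne_bot (hG.ne_bot q)] at h0
    exact EReal.coe_ne_top _ (top_le_iff.1 h0)
  have hgq : conjugate g q ≠ ⊤ := by
    intro h
    rw [h, EReal.add_top_of_ne_bot (hF.ne_bot p)] at h0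
    exact EReal.coe_ne_top _ (top_le_iff.1 h0)
  have key' : ∀ u v, f u ≠ ⊤ → conjugate g v ≠ ⊤ → (f p).toReal + (conjugate g q).toReal ≤
      (f u).toReal + (conjugate g v).toReal - inner ℝ v (A p) + inner ℝ (A u) q := by
    intro u v hu hv
    have h := key u v hu hv
    rwa [← hF.coe_toReal hfp, ← hG.coe_toReal hgq, ← EReal.coe_add, EReal.coe_le_coe_iff] at h
  refine ⟨⟨hF.ne_bot p, hfp, fun u => ?_⟩, ⟨hG.ne_bot q, hgq, fun v => ?_⟩⟩
  · by_cases hu : f u = ⊤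
    · simp [hu]
    -- Choosing v = q isolates the primal inclusion; u = p will isolate the dual one.
    have h := key' u q hu hgq
    simp only
    rw [← hF.coe_toReal hfp, ← hF.coe_toReal hu, ← EReal.coe_add, EReal.coe_le_coe_iff,
      inner_neg_left, ContinuousLinearMap.adjoint_inner_left, map_sub, inner_sub_right,
      real_inner_comm (A u) q]
    linarith
  · by_cases hv : conjugate g v = ⊤
    · simp [hv]
    have h := key' p v hfp hv
    simp only
    rw [← hG.coe_toReal hgq, ← hG.coe_toReal hv, ← EReal.coe_add, EReal.coe_le_coe_iff,
      inner_sub_right, real_inner_comm v (A p)]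
    linarith

theorem IsSaddleFlow.energy_tendsto (H : IsSaddleFlow f g A α β δ x y)
    {p : X × Y} (hp : p ∈ solutions f g A) :
    ∃ m : ℝ, Tendsto (energy A α β δ x y p.1 p.2) atTop (𝓝 m) := by
  have hanti : Antitone fun t : ℝ => energy A α β δ x y p.1 p.2 (max t 0) := fun S T hST =>
    H.energy_antitoneOn hp (le_max_right S 0) (le_max_right T 0) (max_le_max_right 0 hST)
  have hb : BddBelow (range fun t : ℝ => energy A α β δ x y p.1 p.2 (max t 0)) :=
    ⟨0, by rintro _ ⟨t, rfl⟩; exact H.energy_nonneg _ _ (le_max_right t 0)⟩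
  refine ⟨_, (tendsto_atTop_ciInf hanti hb).congr' ?_⟩
  filter_upwards [eventually_ge_atTop 0] with t ht
  rw [max_eq_left ht]

theorem IsSaddleFlow.weakLimitPoints_subsingleton (H : IsSaddleFlow f g A α β δ x y)
    (hint : ¬ IntegrableOn (fun s => 1 / β s) (Ioi 0)) {C₁ C₂ : ℝ}
    (h₁ : ∀ t, 0 ≤ t → α t / β t = C₁) (h₂ : ∀ t, 0 ≤ t → δ t / β t = C₂) :
    (weakLimitPoints (ergodic β x) (ergodic β y)).Subsingleton := by
  intro p hp q hq
  have hpS := H.weakLimitPoints_subset hint hp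
  have hqS := H.weakLimitPoints_subset hint hq
  obtain ⟨c, hc, hcoe⟩ := H.exists_coercive
  obtain ⟨mp, hmp⟩ := H.energy_tendsto hpS
  obtain ⟨mq, hmq⟩ := H.energy_tendsto hqS
  let d := q.1 - p.1
  let e := q.2 - p.2
  -- the differential of the difference of the two energies
  let a : X := C₁ • d + A.adjoint e
  let b : Y := C₂ • e + A d
  let K : ℝ := C₁ / 2 * (‖p.1‖ ^ 2 - ‖q.1‖ ^ 2) + C₂ / 2 * (‖p.2‖ ^ 2 - ‖q.2‖ ^ 2) +
    (inner ℝ (A p.1) p.2 - inner ℝ (A q.1) q.2)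
  -- With constant ratios the terms quadratic in (x, y) cancel, leaving a linear part and the
  -- constant K.
  have hdiff : ∀ t, 0 ≤ t → energy A α β δ x y p.1 p.2 t - energy A α β δ x y q.1 q.2 t - K =
      inner ℝ a (x t) + inner ℝ b (y t) := by
    intro t ht
    simp only [energy, h₁ t ht, h₂ t ht, a, b, K, d, e, norm_sub_sq_real, inner_add_left,
      inner_sub_left, inner_sub_right, real_inner_smul_left, map_sub,
      ContinuousLinearMap.adjoint_inner_left]
    rw [real_inner_comm q.1 (x t), real_inner_comm p.1 (x t), real_inner_comm q.2 (y t),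
      real_inner_comm p.2 (y t), real_inner_comm q.2 (A (x t)), real_inner_comm p.2 (A (x t))]
    ring
  have hlim : Tendsto (fun t => inner ℝ a (x t) + inner ℝ b (y t)) atTop (𝓝 (mp - mq - K)) := by
    refine ((hmp.sub hmq).sub_const K).congr' ?_
    filter_upwards [eventually_ge_atTop 0] with t ht using hdiff t ht
  have hx := H.continuousOn_x
  have hy := H.continuousOn_y
  have hw := H.continuousOn_weight
  have hc0 : ContinuousOn (fun s => 1 / β s * (inner ℝ a (x s) + inner ℝ b (y s))) (Ici 0) := by
    fun_prop
  have hc1 : ContinuousOn (fun s => 1 / β s * inner ℝ a (x s)) (Ici 0) := by fun_prop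
  have hc2 : ContinuousOn (fun s => 1 / β s * inner ℝ b (y s)) (Ici 0) := by fun_prop
  have hces := tendsto_weighted_average (fun T hT => hw.intervalIntegrable_of_Ici le_rfl hT)
    (fun t ht => (H.weight_pos ht).le) (H.mass_tendsto hint)
    (fun T hT => hc0.intervalIntegrable_of_Ici le_rfl hT) hlim
  have herg : Tendsto (fun t => inner ℝ a (ergodic β x t) + inner ℝ b (ergodic β y t)) atTop
      (𝓝 (mp - mq - K)) := by
    refine hces.congr' ?_
    filter_upwards [eventually_ge_atTop 0] with t ht
    have h1 := map_ergodic ((hw.smul hx).intervalIntegrable_of_Ici le_rfl ht) (innerSL ℝ a)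
    have h2 := map_ergodic ((hw.smul hy).intervalIntegrable_of_Ici le_rfl ht) (innerSL ℝ b)
    simp only [innerSL_apply_apply] at h1 h2
    rw [h1, h2, ← mul_add, ← intervalIntegral.integral_add
      (hc1.intervalIntegrable_of_Ici le_rfl ht) (hc2.intervalIntegrable_of_Ici le_rfl ht)]
    simp only [mul_add]
  have hval : ∀ r ∈ weakLimitPoints (ergodic β x) (ergodic β y),
      inner ℝ a r.1 + inner ℝ b r.2 = mp - mq - K := by
    rintro r ⟨τ, hτ, hr1, hr2⟩
    exact tendsto_nhds_unique ((hr1.inner_tendsto a).add (hr2.inner_tendsto b)) (herg.comp hτ)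
  have hzero : inner ℝ a d + inner ℝ b e = 0 := by
    have := (hval q hq).trans (hval p hp).symm
    simp only [d, e, inner_sub_right]
    linarith
  -- `hzero` expands to C₁‖d‖² + C₂‖e‖² + 2⟨Ad, e⟩ = 0, twice the coercive quadratic form at (d, e).
  have hquad := hcoe 0 le_rfl d e
  rw [h₁ 0 le_rfl, h₂ 0 le_rfl] at hquad
  simp only [a, b, inner_add_left, real_inner_smul_left, ContinuousLinearMap.adjoint_inner_left,
    real_inner_self_eq_norm_sq] at hzero
  rw [real_inner_comm] at hzero
  have hle : c * (‖d‖ ^ 2 + ‖e‖ ^ 2) ≤ 0 := by linarith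
  have hle' : ‖d‖ ^ 2 + ‖e‖ ^ 2 ≤ 0 := nonpos_of_mul_nonpos_right hle hc
  have hd : ‖d‖ = 0 := by nlinarith [sq_nonneg ‖d‖, sq_nonneg ‖e‖]
  have he : ‖e‖ = 0 := by nlinarith [sq_nonneg ‖d‖, sq_nonneg ‖e‖]
  rw [norm_eq_zero, sub_eq_zero] at hd he
  exact (Prod.ext hd he).symm

theorem IsSaddleFlow.exists_tendstoWeakly_ergodic (H : IsSaddleFlow f g A α β δ x y)
    (hint : ¬ IntegrableOn (fun s => 1 / β s) (Ioi 0)) (hS : (solutions f g A).Nonempty)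
    (hsub : (weakLimitPoints (ergodic β x) (ergodic β y)).Subsingleton) :
    ∃ p ∈ solutions f g A,
      TendstoWeakly (ergodic β x) atTop p.1 ∧ TendstoWeakly (ergodic β y) atTop p.2 := by
  obtain ⟨C, hC⟩ := H.exists_ergodic_bound hS
  obtain ⟨p, hp⟩ := weakLimitPoints_nonempty hC
  exact ⟨p, H.weakLimitPoints_subset hint hp,
    tendstoWeakly_of_weakLimitPoints_subset hC fun q hq => hsub hq hp⟩

end Flow
end PrimalDual

/-! ### The main theorem -/

theorem theorem4 {X Y : Type*}
    [NormedAddCommGroup X] [InnerProductSpace ℝ X] [CompleteSpace X]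
    [NormedAddCommGroup Y] [InnerProductSpace ℝ Y] [CompleteSpace Y]
    (f : X → EReal) (g : Y → EReal) (A : X →L[ℝ] Y)
    (hf : GammaZero f) (hg : GammaZero g)
    (α β δ : ℝ → ℝ)
    (hα : LocallyAbsCont α) (hβ : LocallyAbsCont β) (hδ : LocallyAbsCont δ)
    (hβ_pos : ∀ t, 0 ≤ t → 0 < β t)
    (hσ : AntitoneOn (fun t => α t / β t) (Ici 0))
    (hτ : AntitoneOn (fun t => δ t / β t) (Ici 0))
    (hc : ‖A‖ < min (⨅ t : Ici (0 : ℝ), α t / β t) (⨅ t : Ici (0 : ℝ), δ t / β t))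
    (x : ℝ → X) (y : ℝ → Y)
    (hxy : IsTrajectory f g A α β β δ x y) :
    -- boundedness and existence of weak limit points
    ((solutions f g A).Nonempty →
      (∃ C : ℝ, ∀ t, 0 ≤ t → ‖x t‖ ≤ C ∧ ‖y t‖ ≤ C) ∧
      (∃ C : ℝ, ∀ t, 0 < t → ‖ergodic β x t‖ ≤ C ∧ ‖ergodic β y t‖ ≤ C) ∧
      (weakLimitPoints x y).Nonempty ∧
      (weakLimitPoints (ergodic β x) (ergodic β y)).Nonempty) ∧
    -- ergodic duality gap
    (∀ (u : X) (v : Y) (t : ℝ), 0 < t →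
      lagrangian f g A (ergodic β x t) v - lagrangian f g A u (ergodic β y t) ≤
        (((∫ s in (0 : ℝ)..t, 1 / β s)⁻¹ * energy A α β δ x y u v 0 : ℝ) : EReal)) ∧
    -- weighted Bregman divergence
    (∀ p ∈ solutions f g A,
      (∀ᵐ s ∂(volume.restrict (Ioi (0 : ℝ))),
        0 ≤ bregman f g A α β β δ x y p.1 p.2 s ∧ bregman f g A α β β δ x y p.1 p.2 s ≠ ⊤) ∧
      IntegrableOn (fun s => (bregman f g A α β β δ x y p.1 p.2 s).toReal / β s) (Ioi 0) ∧
      ∀ t, 0 ≤ t →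
        ∫ s in (0 : ℝ)..t, (bregman f g A α β β δ x y p.1 p.2 s).toReal / β s ≤
          energy A α β δ x y p.1 p.2 0) ∧
    -- weak limit points of the ergodic trajectory
    (¬ IntegrableOn (fun s => 1 / β s) (Ioi 0) →
      weakLimitPoints (ergodic β x) (ergodic β y) ⊆ solutions f g A) ∧
    -- weak convergence of the ergodic trajectory
    (¬ IntegrableOn (fun s => 1 / β s) (Ioi 0) →
      (((∃ C₁ : ℝ, ∀ t, 0 ≤ t → α t / β t = C₁) ∧ (∃ C₂ : ℝ, ∀ t, 0 ≤ t → δ t / β t = C₂) ∧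
          (solutions f g A).Nonempty) ∨
        (∃! p : X × Y, p ∈ solutions f g A)) →
      ∃ p ∈ solutions f g A,
        TendstoWeakly (ergodic β x) atTop p.1 ∧ TendstoWeakly (ergodic β y) atTop p.2) := by
  have H : IsSaddleFlow f g A α β δ x y := ⟨hf, hg, hα, hβ, hδ, hβ_pos, hσ, hτ, hc, hxy⟩
  refine ⟨fun hS => ?_, fun u v t ht => H.lagrangian_gap_le u v ht, fun p hp => ⟨?_,
    H.bregman_integrableOn hp, fun t ht => H.integral_bregman_le hp ht⟩,
    H.weakLimitPoints_subset, fun hint hcase => ?_⟩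
  · obtain ⟨C, hC⟩ := H.exists_bound hS
    obtain ⟨D, hD⟩ := H.exists_ergodic_bound hS
    exact ⟨⟨C, hC⟩, ⟨D, hD⟩, weakLimitPoints_nonempty fun t ht => hC t ht.le,
      weakLimitPoints_nonempty hD⟩
  · filter_upwards [H.bregman_eq hp] with s ⟨r, hr, hr0, _, _⟩
    rw [hr]
    exact ⟨EReal.coe_nonneg.2 hr0, EReal.coe_ne_top r⟩
  · rcases hcase with ⟨⟨C₁, h₁⟩, ⟨C₂, h₂⟩, hS⟩ | ⟨p, hp, huniq⟩
    · exact H.exists_tendstoWeakly_ergodic hint hS (H.weakLimitPoints_subsingleton hint h₁ h₂)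
    · exact H.exists_tendstoWeakly_ergodic hint ⟨p, hp⟩ fun q hq r hr =>
        (huniq q (H.weakLimitPoints_subset hint hq)).trans
          (huniq r (H.weakLimitPoints_subset hint hr)).symm
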